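/- Let $F$ be a totally real number field of degree $n$ with real embeddings $\sigma_1,\dots,\sigma_n$, let $F^+$ be the set of its totally positive elements, and let $L\subset F$ be a lattice of rank $n$ (a finitely generated subgroup spanning $F$ over $\mathbb{Q}$). Let $\alpha_1,\dots,\alpha_m$ ($1\le m\le n$) be linearly independent primitive vectors of $L$ such that the cone $C=\sum_{j=1}^m\mathbb{Q}_{\ge 0}\alpha_j$ is contained in $F^+\cup\{0\}$, and let $v\in F/L$ be non-zero. For $\operatorname{Re}(s)>1$ put $$\zeta(C,L,v,s)=\sum_{\mu\in C\cap(v+L)}N_{F/\mathbb{Q}}(\mu)^{-s}.$$ For a linear form $x$ on $F$ with $x(\alpha_j)\ne 0$ for all $j$, let $h_0(C,v)(w,x)$ be the coefficient of $t^0$ in the Laurent expansion at $t=0$ of $$e^{wt}\,\frac{\sum_{\delta\in P\cap(v+L)}e^{t x(\delta)}}{\prod_{j=1}^m(1-e^{t x(\alpha_j)})},\qquad P=\Big\{\sum_{j}\mu_j\alpha_j : 0\le\mu_j<1\Big\}.$$ Then the series converges absolutely for $\operatorname{Re}(s)>1$, it has a meromorphic continuation to $\mathbb{C}$ which is analytic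 at $s=0$, and $$\zeta(C,L,v,0)=\frac1n\sum_{k=1}^n h_0(C,v)(0,-\sigma_k).$$ In particular, fix an orientation of $L$ by a $\mathbb{Z}$-basis, suppose that $m=n$, and let $a_1,\dots,a_n\in\operatorname{Hom}_{\mathbb{Z}}(L,\mathbb{Z})$ be such that $C=c^\vee(a_1,\dots,a_n)=\{x\in F: a_j(x)\ge 0\text{ for all }j\}$ and $\det(a_1,\dots,a_n)>0$, where the $a_j$ are extended $\mathbb{Q}$-linearly to $F$. Then $$\zeta(C,L,v,0)=\frac1n\sum_{k=1}^n B_{n,a_1,\dots,a_n}(v)(0,-\sigma_k).$$ Here $$B_{n,a_1,\dots,a_n}(v)(w,x)=\frac{\epsilon}{n!\prod_j x(\beta_j)}\sum_{\delta}B^*_{n,n}\big(w+x(\delta),x(\beta_1),\dots,x(\beta_n)\big),$$ where $\beta_1,\dots,\beta_n$ are the primitive vectors of $L$ with $a_j(\beta_j)>0$ and $a_k(\beta_j)=0$ for $k\ne j$, the sum is over the $\delta\in v+L$ with $0\le a_j(\delta)<a_j(\beta_j)$ for all $j$, $\epsilon$ is the sign of $(-1)^n\det(a_1,\dots,a_n)$,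 and $e^{zt}\prod_{j=1}^n\frac{\omega_jt}{e^{\omega_jt}-1}=\sum_{k\ge0}B^*_{n,k}(z,\omega)\frac{t^k}{k!}$. Furthermore there is an element $\beta\in F$ with $\sigma_k(\beta)=\frac1n h_0(C,v)(0,-\sigma_k)$ for all $k$; thus $\zeta(C,L,v,0)=\operatorname{Tr}_{F/\mathbb{Q}}(\beta)$ is the trace of an element of $F$, and it is rational. -/

import Mathlib

namespace ShintaniCone

noncomputable section

/-! ### Lattices, cones and totally positive elements

Throughout, `F` is a field of characteristic zero (in the theorem, a totally real number field),
seen as a `ℚ`-vector space, and `L ⊆ F` is a `ℤ`-lattice. -/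

/-- `x` is a primitive element of the `ℤ`-module `L`: `x ∈ L`, and `x = d • y` with `d ≥ 1` and
`y ∈ L` forces `d = 1`. (In particular `x ≠ 0`.) -/
def IsPrimitiveIn {F : Type*} [Field F] (L : Submodule ℤ F) (x : F) : Prop :=
  x ∈ L ∧ ∀ d : ℕ, 1 ≤ d → ∀ y ∈ L, x = d • y → d = 1

/-- The totally positive elements of `F`: those that are positive under every real embedding. -/
def totallyPositive (F : Type*) [Field F] : Set F :=
  {x | ∀ σ : F →+* ℝ, 0 < σ x}

/-- The closed cone `∑ j, ℚ≥0 α_j`. -/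
def closedCone {F : Type*} [Field F] [CharZero F] {m : ℕ} (α : Fin m → F) : Set F :=
  {x | ∃ c : Fin m → ℚ, (∀ j, 0 ≤ c j) ∧ x = ∑ j, c j • α j}

/-- The half-open parallelotope `{∑ j, μ_j α_j | 0 ≤ μ_j < 1}`. -/
def parallelotope {F : Type*} [Field F] [CharZero F] {m : ℕ} (α : Fin m → F) : Set F :=
  {x | ∃ c : Fin m → ℚ, (∀ j, 0 ≤ c j ∧ c j < 1) ∧ x = ∑ j, c j • α j}

/-- The dual cone `{x | a_j(x) ≥ 0 for all j}` of a family of `ℚ`-linear forms. -/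
def dualCone {F : Type*} [Field F] [CharZero F] {n : ℕ} (a : Fin n → Module.Dual ℚ F) : Set F :=
  {x | ∀ j, 0 ≤ a j x}

/-- The class `v ∈ F / L`, as the subset `v + L` of `F`. -/
def coset {F : Type*} [Field F] {L : Submodule ℤ F} (v : F ⧸ L) : Set F :=
  {x | (Submodule.Quotient.mk x : F ⧸ L) = v}

/-! ### The zeta function of a cone -/

/-- `Z` is (a meromorphic continuation to `ℂ` of) the zeta function
`ζ(C, L, v, s) = ∑_{μ ∈ C ∩ (v + L)} N(μ)^(-s)`: the series converges absolutely for `Re s > 1`,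
with sum `Z s`, and `Z` is meromorphic on the whole complex plane. By the identity theorem any two
such `Z` agree at every point where both are analytic. -/
def IsConeZeta {F : Type*} [Field F] [NumberField F] {L : Submodule ℤ F} (C : Set F) (v : F ⧸ L)
    (Z : ℂ → ℂ) : Prop :=
  Meromorphic Z ∧
    ∀ s : ℂ, 1 < s.re →
      HasSum (fun μ : ↥(C ∩ coset v) => ((Algebra.norm ℚ (μ : F) : ℚ) : ℂ) ^ (-s)) (Z s)

/-! ### The coefficient `h_0`

In `h_0` and in the Bernoulli functions below, `x` is a linear form on `F` with values in any
field `K` of characteristic zero; the classical case is `K = ℝ` or `K = ℂ`. -/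

/-- The exponential series `e^(c t)` as a formal Laurent series in `t`. -/
def expSeries {K : Type*} [Field K] [CharZero K] (c : K) : LaurentSeries K :=
  HahnSeries.ofPowerSeries ℤ K (PowerSeries.rescale c (PowerSeries.exp K))

/-- The Solomon-Hu pairing `h(C, v)(t x)` of the simplicial cone `C = ∑ j, ℚ≥0 α_j` with linearly
independent generators `α_j` in `L`, as a Laurent series in `t`:
`(∑_{δ ∈ P ∩ (v + L)} e^(t x(δ))) / ∏_j (1 - e^(t x(α_j)))` with `P` the half-open parallelotope.
It is the value at `y = e^(t x)` of the generating function
`∑_{δ ∈ C ∩ (v + L)} y^δ = (∑_{δ ∈ P ∩ (v + L)} y^δ) / ∏_j (1 - y^(α_j))` of the cone. It is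
meaningful when no `x(α_j)` is zero. -/
def solomonHu {F K : Type*} [Field F] [CharZero F] [Field K] [CharZero K] {L : Submodule ℤ F}
    {m : ℕ} (α : Fin m → F) (v : F ⧸ L) (x : F →ₗ[ℚ] K) : LaurentSeries K :=
  (∑ᶠ δ ∈ parallelotope α ∩ coset v, expSeries (x δ)) / ∏ j, (1 - expSeries (x (α j)))

/-- `h_0(C, v)(w, x)`, for `C = ∑ j, ℚ≥0 α_j`: the coefficient of `t^0` in
`e^(w t) h(C, v)(t x)`. -/
def hZero {F K : Type*} [Field F] [CharZero F] [Field K] [CharZero K] {L : Submodule ℤ F}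
    {m : ℕ} (α : Fin m → F) (v : F ⧸ L) (w : K) (x : F →ₗ[ℚ] K) : K :=
  (expSeries w * solomonHu α v x).coeff 0

/-! ### Geometric Bernoulli rational functions -/

/-- The multiple Bernoulli polynomial `B*_{n,k}(z, ω)`, defined by
`e^(z t) ∏_j (ω_j t / (e^(ω_j t) - 1)) = ∑_k B*_{n,k}(z, ω) t^k / k!`
(`bernoulliPowerSeries` is `t / (e^t - 1)`). -/
def multipleBernoulli {K : Type*} [Field K] [CharZero K] {n : ℕ} (k : ℕ) (z : K) (ω : Fin n → K) :
    K :=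
  (k.factorial : K) * PowerSeries.coeff k
    (PowerSeries.rescale z (PowerSeries.exp K) *
      ∏ j, PowerSeries.rescale (ω j) (bernoulliPowerSeries K))

/-- The determinant of `(a_1, …, a_n)` in the basis dual to the `ℤ`-basis `b` of `L`. -/
def formDet {F : Type*} [Field F] [CharZero F] {L : Submodule ℤ F} {n : ℕ}
    (b : Module.Basis (Fin n) ℤ L) (a : Fin n → Module.Dual ℚ F) : ℚ :=
  (Matrix.of fun i j => a i (b j : F)).det

/-- `α` is a primitive positive dual family in `L` to the linear forms `a`. -/
def IsPrimitivePositiveDual {F : Type*} [Field F] [CharZero F] (L : Submodule ℤ F) {n : ℕ}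
    (a : Fin n → Module.Dual ℚ F) (α : Fin n → F) : Prop :=
  (∀ j, IsPrimitiveIn L (α j)) ∧ (∀ j, 0 < a j (α j)) ∧ ∀ j k, k ≠ j → a k (α j) = 0

/-- The finite set `F(a, v) = {δ ∈ v + L | 0 ≤ a_j(δ) < a_j(α_j) for all j}`. -/
def dualBox {F : Type*} [Field F] [CharZero F] {L : Submodule ℤ F} {n : ℕ}
    (a : Fin n → Module.Dual ℚ F) (α : Fin n → F) (v : F ⧸ L) : Set F :=
  {δ | δ ∈ coset v ∧ ∀ j, 0 ≤ a j δ ∧ a j δ < a j (α j)}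

open Classical in
/-- The geometric Bernoulli rational function
`B_{n,a}(v)(w, x) = (∏_j x(α_j))⁻¹ (ε / n!) ∑_{δ ∈ F(a, v)} B*_{n,n}(w + x(δ), x(α_1), …, x(α_n))`,
where `α` is the primitive positive dual family to `a` in `L` and `ε` is the sign of
`(-1)^n det(a_1, …, a_n)`, for the orientation given by the basis `b` of `L`. When `L` has rank `n`,
a primitive positive dual family exists exactly when the `a_j` are linearly independent, and it is
then unique; for linearly dependent `a_j` the function is zero by convention. -/
def geometricBernoulli {F K : Type*} [Field F] [CharZero F] [Field K] [CharZero K]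
    {L : Submodule ℤ F} {n : ℕ} (b : Module.Basis (Fin n) ℤ L) (a : Fin n → Module.Dual ℚ F)
    (v : F ⧸ L) (w : K) (x : F →ₗ[ℚ] K) : K :=
  if h : ∃ α : Fin n → F, IsPrimitivePositiveDual L a α then
    (∏ j, x (h.choose j))⁻¹ *
      ((((SignType.sign ((-1) ^ n * formDet b a) : ℤ) : K) / (n.factorial : K)) *
        ∑ᶠ δ ∈ dualBox a h.choose v,
          multipleBernoulli n (w + x δ) (fun j => x (h.choose j)))
  else 0

/-- The real embedding `σ` as a `ℚ`-linear form on `F`. -/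
def embForm {F : Type*} [Field F] [CharZero F] (σ : F →+* ℝ) : F →ₗ[ℚ] ℝ :=
  σ.toRatAlgHom.toLinearMap

end

end ShintaniCone

/-!
The points of the cone in `v + L` are the translates `δ + ∑ x_j α_j`, `x ∈ ℕ^m`, of the finitely
many `δ` in the half-open parallelotope, and none of these is zero because `v ≠ 0`. So the zeta
function is a finite sum of series `∑_{x ∈ ℕ^m} ∏_σ ℓ_σ(x)^(-s)` with positive affine forms
`ℓ_σ(x) = σ(δ) + ∑ σ(α_j) x_j`, and it suffices to treat one of them. The idea is to give each form
its own exponent.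

*Continuation.* Let `S(s) = ∑_x ∏ ℓ_i(x)^(-s_i)` for `s ∈ ℂ^n`. For a symbol `q` of order `d` (a
combination of monomials `x^b / ℓ^a`, up to a bounded symbol of low order) the sum over `x` of the
finite differences of `x_j q ∏ ℓ_i^(-s_i)` is zero, there being no boundary term since `x_j q`
vanishes for `x_j = 0`. Taylor's formula and Euler's relation for homogeneous functions turn the sum
of these differences over `j` into `(m + d - ∑ s_i) q ∏ ℓ_i^(-s_i)` plus symbols of order `d - 1`
(`eulerSym_monom`). This moves the domain of holomorphy to the left by one unit at the price of one
linear factor in `∑ s_i` (`hasContinuation_monom_succ`), and the factors are those of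
`1 / Γ(∑ s_i - m)`. Hence `W(s) = S(s) / Γ(∑ s_i - m)` is holomorphic on all of `ℂ^n`
(`exists_continuation`, stated on half-spaces).

*Value at zero.* The function `1 / Γ(∑ s_i - m)` has a simple zero along `∑ s_i = 0`, so the value
of `S` at `0` along the diagonal is read off from the differential of `W` at `0`, and a differential
is determined by its restrictions to the coordinate axes. This is where the average `(1/n) ∑_σ` comes
from (`hasDerivAt_diagonal`, `exists_zeta`). On the axis of `σ` the function `S` is the Barnes zeta
function `∑_x ℓ_σ(x)^(-z)`, the Mellin transform of `e^(-σ(δ) t) / ∏ (1 - e^(-σ(α_j) t))` divided by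
`Γ(z)`; subtracting the polar part at `t = 0` shows that its value at `0` is the constant term of
that function (`exists_barnes_continuation`), the contribution of `δ` to `h_0(0, -σ)`.

*The remaining claims.* The coefficient `h_0` is a finite sum of coefficients of power series
(`hZero_eq_sum`), so it is natural in the field of values (`map_hZero`): `β` is `1/n` times `h_0` of
the form `-id` on `F`. If the cone is dual to `a_1, …, a_n`, then the matrix `(a_k(α_j))` and its
inverse are both nonnegative, so the `α_j` are, up to order, the primitive vectors `β_j`
(`exists_perm_dual`), and the Bernoulli function is `h_0` (`geometricBernoulli_eq_hZero`).
-/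

namespace ShintaniCone

/-! ### Symbols on `ℕ^κ`: functions with a locally uniform order of growth -/

section Symbols

variable {ι κ : Type*} [Fintype ι] [Fintype κ]

/-- The affine form `x ↦ c + ∑ j, l j * x j` on `ℕ^κ`. -/
noncomputable def affineForm (c : ℝ) (l : κ → ℝ) (x : κ → ℕ) : ℝ := c + ∑ j, l j * x j

/-- The size `1 + ∑ j, x j` of a point of `ℕ^κ`. -/
noncomputable def size (x : κ → ℕ) : ℝ := 1 + ∑ j, (x j : ℝ)

lemma one_le_size (x : κ → ℕ) : 1 ≤ size x := by
  unfold size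
  have : 0 ≤ ∑ j, (x j : ℝ) := Finset.sum_nonneg fun j _ => by positivity
  linarith

lemma size_pos (x : κ → ℕ) : 0 < size x := lt_of_lt_of_le one_pos (one_le_size x)

lemma coord_le_size (x : κ → ℕ) (j : κ) : (x j : ℝ) + 1 ≤ size x := by
  unfold size
  have : (x j : ℝ) ≤ ∑ j, (x j : ℝ) :=
    Finset.single_le_sum (f := fun j => (x j : ℝ)) (fun j _ => by positivity) (Finset.mem_univ j)
  linarith

lemma affineForm_pos {c : ℝ} {l : κ → ℝ} (hc : 0 < c) (hl : ∀ j, 0 < l j) (x : κ → ℕ) :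
    0 < affineForm c l x := by
  unfold affineForm
  have : 0 ≤ ∑ j, l j * (x j : ℝ) :=
    Finset.sum_nonneg fun j _ => mul_nonneg (hl j).le (by positivity)
  linarith

lemma le_affineForm {c : ℝ} {l : κ → ℝ} (hl : ∀ j, 0 < l j) (x : κ → ℕ) :
    c ≤ affineForm c l x := by
  unfold affineForm
  have : 0 ≤ ∑ j, l j * (x j : ℝ) :=
    Finset.sum_nonneg fun j _ => mul_nonneg (hl j).le (by positivity)
  linarith

/-- A positive affine form is comparable to the size. -/
lemma exists_affineForm_comparable {c : ℝ} {l : κ → ℝ} (hc : 0 < c) (hl : ∀ j, 0 < l j) :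
    ∃ A : ℝ, 1 ≤ A ∧ ∀ x, affineForm c l x ≤ A * size x ∧ size x ≤ A * affineForm c l x := by
  set A : ℝ := 1 + (c + c⁻¹ + ∑ j, (l j + (l j)⁻¹)) with hA
  have hsum : ∀ j, l j + (l j)⁻¹ ≤ ∑ j, (l j + (l j)⁻¹) := fun j =>
    Finset.single_le_sum (f := fun j => l j + (l j)⁻¹)
      (fun j _ => by have := hl j; positivity) (Finset.mem_univ j)
  have hsum0 : 0 ≤ ∑ j, (l j + (l j)⁻¹) :=
    Finset.sum_nonneg fun j _ => by have := hl j; positivity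
  have hci : 0 < c⁻¹ := inv_pos.2 hc
  refine ⟨A, by linarith, fun x => ⟨?_, ?_⟩⟩
  · unfold affineForm size
    rw [mul_add, Finset.mul_sum]
    refine add_le_add (by linarith) (Finset.sum_le_sum fun j _ => ?_)
    have := hsum j
    have h2 : 0 < (l j)⁻¹ := inv_pos.2 (hl j)
    exact mul_le_mul_of_nonneg_right (by linarith) (by positivity)
  · unfold affineForm size
    rw [mul_add, Finset.mul_sum]
    refine add_le_add ?_ (Finset.sum_le_sum fun j _ => ?_)
    · have : c⁻¹ * c = 1 := inv_mul_cancel₀ hc.ne'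
      nlinarith
    · have := hsum j
      have h1 := hl j
      have h2 : (l j)⁻¹ * l j = 1 := inv_mul_cancel₀ h1.ne'
      have h3 : 1 ≤ A * l j := by
        rw [← h2]
        exact mul_le_mul_of_nonneg_right (by linarith) h1.le
      rw [← mul_assoc]
      nlinarith [(by positivity : (0 : ℝ) ≤ (x j : ℝ))]

/-- The symbols of order `d`: functions of `s ∈ ℂ^ι` and `x ∈ ℕ^κ` that are entire in `s` and
`O(size x ^ d)` locally uniformly in `s`. -/
noncomputable def boundedSym (ι κ : Type*) [Fintype ι] [Fintype κ] (d : ℤ) :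
    Submodule ℂ ((ι → ℂ) → (κ → ℕ) → ℂ) where
  carrier := {q | (∀ x, Differentiable ℂ fun s => q s x) ∧
    ∀ R : ℝ, ∃ C : ℝ, 0 ≤ C ∧ ∀ s, ‖s‖ ≤ R → ∀ x, ‖q s x‖ ≤ C * size x ^ d}
  zero_mem' := ⟨fun x => differentiable_const 0, fun R => ⟨0, le_rfl, fun s _ x => by simp⟩⟩
  add_mem' := by
    rintro p q ⟨hp, hp'⟩ ⟨hq, hq'⟩
    refine ⟨fun x => (hp x).add (hq x), fun R => ?_⟩
    obtain ⟨C, hC0, hC⟩ := hp' R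
    obtain ⟨D, hD0, hD⟩ := hq' R
    refine ⟨C + D, by positivity, fun s hs x => ?_⟩
    rw [add_mul]
    exact (norm_add_le _ _).trans (add_le_add (hC s hs x) (hD s hs x))
  smul_mem' := by
    rintro a q ⟨hq, hq'⟩
    refine ⟨fun x => (hq x).const_smul a, fun R => ?_⟩
    obtain ⟨C, hC0, hC⟩ := hq' R
    refine ⟨‖a‖ * C, by positivity, fun s hs x => ?_⟩
    simp only [Pi.smul_apply, norm_smul, mul_assoc]
    exact mul_le_mul_of_nonneg_left (hC s hs x) (norm_nonneg a)

lemma boundedSym_mono {d e : ℤ} (h : d ≤ e) : boundedSym ι κ d ≤ boundedSym ι κ e := by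
  rintro q ⟨hq, hq'⟩
  refine ⟨hq, fun R => ?_⟩
  obtain ⟨C, hC0, hC⟩ := hq' R
  exact ⟨C, hC0, fun s hs x => (hC s hs x).trans
    (mul_le_mul_of_nonneg_left (zpow_le_zpow_right₀ (one_le_size x) h) hC0)⟩

lemma boundedSym_mul_mem {d e : ℤ} {p q : (ι → ℂ) → (κ → ℕ) → ℂ}
    (hp : p ∈ boundedSym ι κ d) (hq : q ∈ boundedSym ι κ e) :
    p * q ∈ boundedSym ι κ (d + e) := by
  obtain ⟨hp, hp'⟩ := hp
  obtain ⟨hq, hq'⟩ := hq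
  refine ⟨fun x => (hp x).mul (hq x), fun R => ?_⟩
  obtain ⟨C, hC0, hC⟩ := hp' R
  obtain ⟨D, hD0, hD⟩ := hq' R
  refine ⟨C * D, by positivity, fun s hs x => ?_⟩
  rw [zpow_add₀ (size_pos x).ne']
  simp only [Pi.mul_apply, norm_mul]
  calc _ ≤ (C * size x ^ d) * (D * size x ^ e) :=
        mul_le_mul (hC s hs x) (hD s hs x) (norm_nonneg _)
          (mul_nonneg hC0 (zpow_nonneg (size_pos x).le _))
    _ = _ := by ring

lemma entire_mem_boundedSym {e : (ι → ℂ) → ℂ} (he : Differentiable ℂ e) :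
    (fun s _ => e s) ∈ boundedSym ι κ 0 := by
  refine ⟨fun _ => he, fun R => ?_⟩
  obtain ⟨C, hC⟩ := (isCompact_closedBall (0 : ι → ℂ) R).exists_bound_of_continuousOn
    he.continuous.continuousOn
  refine ⟨max C 0, le_max_right _ _, fun s hs x => ?_⟩
  simpa using (hC s (by simpa using hs)).trans (le_max_left C 0)

lemma coord_mem_boundedSym (j : κ) :
    (fun _ x => (x j : ℂ)) ∈ boundedSym ι κ 1 := by
  refine ⟨fun x => differentiable_const _, fun R => ⟨1, zero_le_one, fun s _ x => ?_⟩⟩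
  have := coord_le_size x j
  simp
  linarith

lemma inv_affineForm_mem_boundedSym {c : ℝ} {l : κ → ℝ} (hc : 0 < c) (hl : ∀ j, 0 < l j) :
    (fun _ x => ((affineForm c l x : ℂ))⁻¹) ∈ boundedSym ι κ (-1) := by
  obtain ⟨A, hA, h⟩ := exists_affineForm_comparable hc hl
  refine ⟨fun x => differentiable_const _, fun R => ⟨A, by linarith, fun s _ x => ?_⟩⟩
  have h1 := affineForm_pos hc hl x
  have h2 := size_pos x
  rw [norm_inv, Complex.norm_real, Real.norm_of_nonneg h1.le, zpow_neg_one, ← div_eq_mul_inv,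
    le_div_iff₀ h2, inv_mul_le_iff₀ h1, mul_comm]
  exact (h x).2

variable (c : ι → ℝ) (l : ι → κ → ℝ)

/-- The monomial `∏ x_j ^ b_j / ∏ ℓ_i(x) ^ a_i`. -/
noncomputable def monom (a : ι → ℕ) (b : κ → ℕ) : (ι → ℂ) → (κ → ℕ) → ℂ := fun _ x =>
  (∏ j, (x j : ℂ) ^ b j) * ∏ i, ((affineForm (c i) (l i) x : ℂ)⁻¹) ^ a i

/-- The span, over the entire functions of `s`, of the monomials of degree at most `d`. -/
noncomputable def polySym (d : ℤ) : Submodule ℂ ((ι → ℂ) → (κ → ℕ) → ℂ) :=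
  Submodule.span ℂ {q | ∃ (e : (ι → ℂ) → ℂ) (a : ι → ℕ) (b : κ → ℕ), Differentiable ℂ e ∧
    (∑ j, (b j : ℤ)) - ∑ i, (a i : ℤ) ≤ d ∧ q = (fun s _ => e s) * monom c l a b}

/-- The symbols of order `d` that agree with a combination of monomials up to order `d - K`. -/
noncomputable def sym (K : ℕ) (d : ℤ) : Submodule ℂ ((ι → ℂ) → (κ → ℕ) → ℂ) :=
  polySym c l d ⊔ boundedSym ι κ (d - K)

variable {c l}

lemma polySym_mono {d e : ℤ} (h : d ≤ e) : polySym c l d ≤ polySym c l e :=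
  Submodule.span_mono fun _ ⟨f, a, b, hf, hab, hq⟩ => ⟨f, a, b, hf, hab.trans h, hq⟩

lemma polySym_mul_mem {d e : ℤ} {p q : (ι → ℂ) → (κ → ℕ) → ℂ} (hp : p ∈ polySym c l d)
    (hq : q ∈ polySym c l e) : p * q ∈ polySym c l (d + e) := by
  have h : polySym c l d * polySym c l e ≤ polySym c l (d + e) := by
    unfold polySym
    rw [Submodule.span_mul_span]
    refine Submodule.span_mono ?_
    rintro _ ⟨_, ⟨f, a, b, hf, hab, rfl⟩, _, ⟨g, a', b', hg, hab', rfl⟩, rfl⟩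
    refine ⟨f * g, a + a', b + b', hf.mul hg, ?_, ?_⟩
    · simp only [Pi.add_apply, Nat.cast_add, Finset.sum_add_distrib]
      linarith
    · funext s x
      simp only [monom, Pi.mul_apply, Pi.add_apply, pow_add, Finset.prod_mul_distrib]
      ring
  exact h (Submodule.mul_mem_mul hp hq)

lemma one_mem_boundedSym : (1 : (ι → ℂ) → (κ → ℕ) → ℂ) ∈ boundedSym ι κ 0 :=
  entire_mem_boundedSym (differentiable_const 1)

lemma boundedSym_prod_mem {A : Type*} (S : Finset A) (d : A → ℤ)
    (f : A → (ι → ℂ) → (κ → ℕ) → ℂ) (h : ∀ i ∈ S, f i ∈ boundedSym ι κ (d i)) :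
    ∏ i ∈ S, f i ∈ boundedSym ι κ (∑ i ∈ S, d i) := by
  classical
  induction S using Finset.induction_on with
  | empty => simpa using one_mem_boundedSym
  | insert i S hi ih =>
    rw [Finset.prod_insert hi, Finset.sum_insert hi]
    exact boundedSym_mul_mem (h i (by simp)) (ih fun j hj => h j (by simp [hj]))

lemma boundedSym_pow_mem {d : ℤ} {f : (ι → ℂ) → (κ → ℕ) → ℂ} (h : f ∈ boundedSym ι κ d) (n : ℕ) :
    f ^ n ∈ boundedSym ι κ (n * d) := by
  simpa using boundedSym_prod_mem (Finset.range n) (fun _ => d) (fun _ => f) fun _ _ => h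

lemma monom_eq (a : ι → ℕ) (b : κ → ℕ) : monom c l a b =
    (∏ j, (fun _ x => (x j : ℂ)) ^ b j) *
      ∏ i, (fun _ x => ((affineForm (c i) (l i) x : ℂ))⁻¹) ^ a i := by
  funext s x
  simp [monom, Finset.prod_apply]

lemma polySym_le_boundedSym (hc : ∀ i, 0 < c i) (hl : ∀ i j, 0 < l i j) (d : ℤ) :
    polySym c l d ≤ boundedSym ι κ d := by
  refine Submodule.span_le.2 ?_
  rintro _ ⟨e, a, b, he, hab, rfl⟩
  refine boundedSym_mono hab ?_
  rw [monom_eq]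
  have h1 := boundedSym_prod_mem (ι := ι) (κ := κ) Finset.univ _ _
    fun j _ => boundedSym_pow_mem (coord_mem_boundedSym j) (b j)
  have h2 := boundedSym_prod_mem (ι := ι) (κ := κ) Finset.univ _ _
    fun i _ => boundedSym_pow_mem (inv_affineForm_mem_boundedSym (hc i) (hl i)) (a i)
  have h3 := boundedSym_mul_mem (entire_mem_boundedSym he) (boundedSym_mul_mem h1 h2)
  convert h3 using 2
  simp [sub_eq_add_neg]

lemma sym_mono (K : ℕ) {d e : ℤ} (h : d ≤ e) : sym c l K d ≤ sym c l K e :=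
  sup_le_sup (polySym_mono h) (boundedSym_mono (by linarith))

lemma polySym_le_sym (K : ℕ) (d : ℤ) : polySym c l d ≤ sym c l K d := le_sup_left

lemma sym_mul_mem (hc : ∀ i, 0 < c i) (hl : ∀ i j, 0 < l i j) {K : ℕ} {d e f : ℤ}
    {p q : (ι → ℂ) → (κ → ℕ) → ℂ} (hp : p ∈ sym c l K d) (hq : q ∈ sym c l K e)
    (hf : d + e ≤ f) : p * q ∈ sym c l K f := by
  refine sym_mono K hf ?_
  obtain ⟨p₁, hp₁, p₂, hp₂, rfl⟩ := Submodule.mem_sup.1 hp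
  obtain ⟨q₁, hq₁, q₂, hq₂, rfl⟩ := Submodule.mem_sup.1 hq
  have h : (p₁ + p₂) * (q₁ + q₂) = p₁ * q₁ + (p₁ * q₂ + (p₂ * q₁ + p₂ * q₂)) := by ring
  rw [h]
  have hp₁' := polySym_le_boundedSym hc hl _ hp₁
  have hq₁' := polySym_le_boundedSym hc hl _ hq₁
  have hK : (0 : ℤ) ≤ K := by positivity
  refine Submodule.add_mem_sup (polySym_mul_mem hp₁ hq₁) (add_mem ?_ (add_mem ?_ ?_))
  · exact boundedSym_mono (by linarith) (boundedSym_mul_mem hp₁' hq₂)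
  · exact boundedSym_mono (by linarith) (boundedSym_mul_mem hp₂ hq₁')
  · exact boundedSym_mono (by linarith) (boundedSym_mul_mem hp₂ hq₂)

lemma entire_mul_monom_mem {e : (ι → ℂ) → ℂ} (he : Differentiable ℂ e) (a : ι → ℕ) (b : κ → ℕ)
    {d : ℤ} (h : (∑ j, (b j : ℤ)) - ∑ i, (a i : ℤ) ≤ d) :
    (fun s _ => e s) * monom c l a b ∈ polySym c l d :=
  Submodule.subset_span ⟨e, a, b, he, h, rfl⟩

lemma entire_mem_polySym {e : (ι → ℂ) → ℂ} (he : Differentiable ℂ e) :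
    (fun s _ => e s) ∈ polySym c l 0 := by
  have := entire_mul_monom_mem (c := c) (l := l) he 0 0 (d := 0) (by simp)
  convert this using 1
  funext s x
  simp [monom]

lemma coord_mem_polySym (j : κ) : (fun _ x => (x j : ℂ)) ∈ polySym c l 1 := by
  classical
  have := entire_mul_monom_mem (c := c) (l := l) (differentiable_const 1) 0 (Pi.single j 1)
    (d := 1) (by simp [Pi.single_apply])
  convert this using 1
  funext s x
  simp [monom, Pi.single_apply, pow_ite]

lemma inv_affineForm_mem_polySym (i : ι) :
    (fun _ x => ((affineForm (c i) (l i) x : ℂ))⁻¹) ∈ polySym c l (-1) := by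
  classical
  have := entire_mul_monom_mem (c := c) (l := l) (differentiable_const 1) (Pi.single i 1) 0
    (d := -1) (by simp [Pi.single_apply])
  convert this using 1
  funext s x
  simp [monom, Pi.single_apply, pow_ite]

end Symbols

/-! ### The binomial series with a uniform remainder -/

section Taylor

/-- The coefficients `binom(-z, p)` of the expansion of `(1 + r) ^ (-z)` at `r = 0`. -/
noncomputable def negBinom : ℕ → ℂ → ℂ
  | 0, _ => 1
  | p + 1, z => -z * negBinom p (z + 1) / (p + 1)

lemma differentiable_negBinom (p : ℕ) : Differentiable ℂ (negBinom p) := by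
  induction p with
  | zero => exact differentiable_const 1
  | succ p ih =>
    have h : negBinom (p + 1) = fun z => -z * negBinom p (z + 1) / (p + 1) := rfl
    rw [h]
    exact ((differentiable_id.neg).mul
      (ih.comp (differentiable_id.add (differentiable_const 1)))).div_const _

/-- Taylor's formula for `(1 + r) ^ (-z)`, with a remainder that is uniform in bounded `r ≥ 0` and
`z`. The derivative of the remainder is `-z` times the remainder of one order less at `z + 1`. -/
lemma exists_norm_cpow_neg_sub_le (K : ℕ) (r₀ R : ℝ) :
    ∃ C : ℝ, 0 ≤ C ∧ ∀ z : ℂ, ‖z‖ ≤ R → ∀ r : ℝ, 0 ≤ r → r ≤ r₀ →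
      ‖(1 + r : ℂ) ^ (-z) - ∑ p ∈ Finset.range K, negBinom p z * r ^ p‖ ≤ C * r ^ K := by
  induction K generalizing R with
  | zero =>
    refine ⟨(1 + |r₀|) ^ |R|, by positivity, fun z hz r hr hr' => ?_⟩
    have h1 : (1 + r : ℂ) = ((1 + r : ℝ) : ℂ) := by push_cast; ring
    have h2 : 0 < 1 + r := by linarith
    rw [Finset.range_zero, Finset.sum_empty, sub_zero, pow_zero, mul_one, h1,
      Complex.norm_cpow_eq_rpow_re_of_pos h2]
    have h3 : (-z).re ≤ |R| :=
      (Complex.re_le_norm _).trans (by rw [norm_neg]; exact hz.trans (le_abs_self R))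
    calc (1 + r) ^ (-z).re ≤ (1 + r) ^ |R| := Real.rpow_le_rpow_of_exponent_le (by linarith) h3
      _ ≤ _ := Real.rpow_le_rpow h2.le (by have := le_abs_self r₀; linarith) (abs_nonneg R)
  | succ K ih =>
    obtain ⟨C, hC0, hC⟩ := ih (R + 1)
    refine ⟨|R| * C, by positivity, fun z hz r hr hr' => ?_⟩
    have hd : ∀ t ∈ Set.Icc 0 r, HasDerivWithinAt
        (fun t : ℝ => (1 + t : ℂ) ^ (-z) - ∑ p ∈ Finset.range (K + 1), negBinom p z * t ^ p)
        (-z * ((1 + t : ℂ) ^ (-(z + 1)) -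
          ∑ p ∈ Finset.range K, negBinom p (z + 1) * t ^ p)) (Set.Icc 0 r) t := by
      intro t ht
      have hslit : (1 + t : ℂ) ∈ Complex.slitPlane := by
        refine Or.inl ?_
        simp
        linarith [ht.1]
      have h1 : HasDerivAt (fun t : ℝ => (1 + t : ℂ)) 1 t := by
        simpa using (Complex.ofRealCLM.hasDerivAt (x := t)).const_add (1 : ℂ)
      have h2 := HasDerivAt.comp_ofReal (e := fun w : ℂ => (1 + w) ^ (-z)) (z := t)
        (((hasDerivAt_id (t : ℂ)).const_add (1 : ℂ)).cpow_const (c := -z) hslit)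
      have h3 : HasDerivAt (fun t : ℝ => ∑ p ∈ Finset.range (K + 1), negBinom p z * (t : ℂ) ^ p)
          (∑ p ∈ Finset.range (K + 1), negBinom p z * (p * (t : ℂ) ^ (p - 1))) t := by
        refine HasDerivAt.fun_sum fun p _ => HasDerivAt.const_mul _ ?_
        exact HasDerivAt.comp_ofReal (e := fun w : ℂ => w ^ p) (hasDerivAt_pow p (t : ℂ))
      refine ((h2.sub h3).congr_deriv ?_).hasDerivWithinAt
      rw [Finset.sum_range_succ', mul_sub, Finset.mul_sum]
      congr 1
      · rw [show -z - 1 = -(z + 1) by ring]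
        simp
      · simp only [Nat.cast_zero, zero_mul, mul_zero, add_zero]
        refine Finset.sum_congr rfl fun p _ => ?_
        have : (p + 1 : ℂ) ≠ 0 := by exact_mod_cast p.succ_ne_zero
        simp only [negBinom, Nat.add_sub_cancel, Nat.cast_add, Nat.cast_one]
        field_simp
    have hb : ∀ t ∈ Set.Icc 0 r, ‖-z * ((1 + t : ℂ) ^ (-(z + 1)) -
        ∑ p ∈ Finset.range K, negBinom p (z + 1) * t ^ p)‖ ≤ |R| * (C * r ^ K) := by
      intro t ht
      rw [norm_mul, norm_neg]
      refine mul_le_mul (hz.trans (le_abs_self R)) ?_ (norm_nonneg _) (abs_nonneg R)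
      refine (hC (z + 1) ((norm_add_le _ _).trans (by simpa using hz)) t ht.1
        (ht.2.trans hr')).trans ?_
      exact mul_le_mul_of_nonneg_left (pow_le_pow_left₀ ht.1 ht.2 K) hC0
    have h := (convex_Icc 0 r).norm_image_sub_le_of_norm_hasDerivWithin_le hd hb
      (Set.left_mem_Icc.2 hr) (Set.right_mem_Icc.2 hr)
    rw [Finset.sum_range_succ' (fun p => negBinom p z * (((0 : ℝ) : ℂ)) ^ p)] at h
    simp only [Complex.ofReal_zero, add_zero, Complex.one_cpow, negBinom, pow_zero, mul_one, ne_eq,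
      Nat.add_eq_zero_iff, one_ne_zero, and_false, not_false_eq_true, zero_pow, mul_zero,
      Finset.sum_const_zero, zero_add, sub_self, sub_zero, Real.norm_of_nonneg hr] at h
    exact h.trans (le_of_eq (by ring))

end Taylor

/-! ### Finite differences of symbols and Euler's relation -/

section Euler

variable {ι κ : Type*} [Fintype ι] [Fintype κ]
variable {c : ι → ℝ} {l : ι → κ → ℝ}

/-- `(1 + l_{ij} / ℓ_i(x)) ^ (-z(s))`, the factor by which `ℓ_i(x) ^ (-z(s))` changes when `x_j`
increases by one. -/
noncomputable def shiftFactor (c : ι → ℝ) (l : ι → κ → ℝ) (z : (ι → ℂ) → ℂ) (i : ι) (j : κ) :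
    (ι → ℂ) → (κ → ℕ) → ℂ :=
  fun s x => (1 + (l i j * (affineForm (c i) (l i) x)⁻¹ : ℝ) : ℂ) ^ (-z s)

lemma shiftFactor_sub_mem (hc : ∀ i, 0 < c i) (hl : ∀ i j, 0 < l i j) {z : (ι → ℂ) → ℂ}
    (hz : Differentiable ℂ z) (K : ℕ) (i : ι) (j : κ) :
    shiftFactor c l z i j - 1 -
      (fun s x => -z s * (l i j * (affineForm (c i) (l i) x : ℂ)⁻¹)) ∈ sym c l K (-2) := by
  set f : (ι → ℂ) → (κ → ℕ) → ℂ := fun _ x => (affineForm (c i) (l i) x : ℂ)⁻¹ with hf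
  set main : (ι → ℂ) → (κ → ℕ) → ℂ := fun s x =>
    ∑ p ∈ Finset.range K, negBinom (p + 2) (z s) *
      (l i j * (affineForm (c i) (l i) x)⁻¹ : ℝ) ^ (p + 2)
  have hmain : main ∈ polySym c l (-2) := by
    have : main = ∑ p ∈ Finset.range K,
        (fun s _ => negBinom (p + 2) (z s) * (l i j : ℂ) ^ (p + 2)) * f ^ (p + 2) := by
      funext s x
      simp only [main, f, Finset.sum_apply, Pi.mul_apply, Pi.pow_apply]
      refine Finset.sum_congr rfl fun p _ => ?_
      push_cast
      ring
    rw [this]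
    refine Submodule.sum_mem _ fun p _ => ?_
    have h1 : (fun s _ => negBinom (p + 2) (z s) * (l i j : ℂ) ^ (p + 2)) ∈ polySym c l 0 :=
      entire_mem_polySym (((differentiable_negBinom _).comp hz).mul_const _)
    have h2 : ∀ n : ℕ, f ^ n ∈ polySym c l (-n) := by
      intro n
      induction n with
      | zero =>
        rw [pow_zero, Nat.cast_zero, neg_zero]
        exact entire_mem_polySym (differentiable_const 1)
      | succ n ih =>
        rw [pow_succ]
        refine polySym_mono ?_ (polySym_mul_mem ih (inv_affineForm_mem_polySym i))
        push_cast
        linarith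
    exact polySym_mono (by push_cast; linarith) (polySym_mul_mem h1 (h2 (p + 2)))
  refine Submodule.mem_sup.2 ⟨main, hmain, shiftFactor c l z i j - 1 -
      (fun s x => -z s * (l i j * (affineForm (c i) (l i) x : ℂ)⁻¹)) - main, ?_, by abel⟩
  have hrem : ∀ s x, (shiftFactor c l z i j - 1 -
      (fun s x => -z s * (l i j * (affineForm (c i) (l i) x : ℂ)⁻¹)) - main) s x =
      (1 + (l i j * (affineForm (c i) (l i) x)⁻¹ : ℝ) : ℂ) ^ (-z s) -
        ∑ p ∈ Finset.range (K + 2), negBinom p (z s) *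
          ((l i j * (affineForm (c i) (l i) x)⁻¹ : ℝ) : ℂ) ^ p := by
    intro s x
    rw [Finset.sum_range_succ', Finset.sum_range_succ']
    simp only [Pi.sub_apply, Pi.one_apply, shiftFactor, main, negBinom]
    push_cast
    ring
  constructor
  · intro x
    simp only [hrem]
    have h1 : (1 + (l i j * (affineForm (c i) (l i) x)⁻¹ : ℝ) : ℂ) ≠ 0 := by
      have := affineForm_pos (hc i) (hl i) x
      have h2 := hl i j
      have : 0 < 1 + l i j * (affineForm (c i) (l i) x)⁻¹ := by positivity
      exact_mod_cast this.ne'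
    refine (Differentiable.const_cpow hz.neg (Or.inl h1)).sub ?_
    exact Differentiable.fun_sum fun p _ => ((differentiable_negBinom _).comp hz).mul_const _
  · intro R
    obtain ⟨D, hD0, hD⟩ := (entire_mem_boundedSym (κ := κ) hz).2 R
    obtain ⟨C, hC0, hC⟩ := exists_norm_cpow_neg_sub_le (K + 2) (l i j * (c i)⁻¹) D
    obtain ⟨A, hA, hcomp⟩ := exists_affineForm_comparable (hc i) (hl i)
    have hlij := hl i j
    refine ⟨C * (l i j * A) ^ (K + 2), by positivity, fun s hs x => ?_⟩
    rw [hrem]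
    have hpos := affineForm_pos (hc i) (hl i) x
    have hsz := size_pos x
    refine (hC (z s) (by simpa using hD s hs x) _ (by positivity) ?_).trans ?_
    · exact mul_le_mul_of_nonneg_left (inv_anti₀ (hc i) (le_affineForm (hl i) x)) hlij.le
    · have h1 : (affineForm (c i) (l i) x)⁻¹ ≤ A * (size x)⁻¹ := by
        rw [← div_eq_mul_inv, le_div_iff₀ hsz, inv_mul_le_iff₀ hpos, mul_comm]
        exact (hcomp x).2
      have h2 : size x ^ ((-2 : ℤ) - (K : ℤ)) = ((size x)⁻¹) ^ (K + 2) := by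
        rw [inv_pow, ← zpow_natCast, ← zpow_neg]
        congr 1
        push_cast
        ring
      rw [h2, mul_assoc C, ← mul_pow]
      refine mul_le_mul_of_nonneg_left (pow_le_pow_left₀ (by positivity) ?_ _) hC0
      rw [mul_assoc]
      exact mul_le_mul_of_nonneg_left h1 hlij.le

/-- `q⁺ j` stands for the effect on the symbol `q` of order `d` of increasing `x_j` by one. The
structure says that the finite differences `q⁺ j - q` have order `d - 1` and that Euler's relation
`∑ j, x_j ∂_j q = θ q` for homogeneous functions of degree `θ` holds for them up to order `d - 1`.
The degree `θ` may depend on `s`. -/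
structure EulerSym (c : ι → ℝ) (l : ι → κ → ℝ) (K : ℕ) (d : ℤ) (θ : (ι → ℂ) → ℂ)
    (q : (ι → ℂ) → (κ → ℕ) → ℂ) (q' : κ → (ι → ℂ) → (κ → ℕ) → ℂ) : Prop where
  mem : q ∈ sym c l K d
  diff : ∀ j, q' j - q ∈ sym c l K (d - 1)
  euler : ∑ j, (fun _ x => (x j : ℂ)) * (q' j - q) - (fun s _ => θ s) * q ∈ sym c l K (d - 1)

lemma EulerSym.mul (hc : ∀ i, 0 < c i) (hl : ∀ i j, 0 < l i j) {K : ℕ} {d₁ d₂ : ℤ}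
    {θ₁ θ₂ : (ι → ℂ) → ℂ} {p q : (ι → ℂ) → (κ → ℕ) → ℂ} {p' q' : κ → (ι → ℂ) → (κ → ℕ) → ℂ}
    (hp : EulerSym c l K d₁ θ₁ p p') (hq : EulerSym c l K d₂ θ₂ q q') :
    EulerSym c l K (d₁ + d₂) (fun s => θ₁ s + θ₂ s) (p * q) (fun j => p' j * q' j) := by
  have key : ∀ j, p' j * q' j - p * q =
      (p' j - p) * q + (p * (q' j - q) + (p' j - p) * (q' j - q)) := fun j => by ring
  refine ⟨sym_mul_mem hc hl hp.mem hq.mem le_rfl, fun j => ?_, ?_⟩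
  · rw [key]
    refine add_mem (sym_mul_mem hc hl (hp.diff j) hq.mem (by linarith)) (add_mem
      (sym_mul_mem hc hl hp.mem (hq.diff j) (by linarith))
      (sym_mul_mem hc hl (hp.diff j) (hq.diff j) (by linarith)))
  · have : ∑ j, (fun _ x => (x j : ℂ)) * (p' j * q' j - p * q) -
        (fun s _ => θ₁ s + θ₂ s) * (p * q) =
        (∑ j, (fun _ x => (x j : ℂ)) * (p' j - p) - (fun s _ => θ₁ s) * p) * q +
        (p * (∑ j, (fun _ x => (x j : ℂ)) * (q' j - q) - (fun s _ => θ₂ s) * q) +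
          ∑ j, (fun _ x => (x j : ℂ)) * ((p' j - p) * (q' j - q))) := by
      have h1 : (fun (s : ι → ℂ) (_ : κ → ℕ) => θ₁ s + θ₂ s) =
        (fun s _ => θ₁ s) + (fun s _ => θ₂ s) := rfl
      rw [h1, sub_mul, mul_sub, Finset.sum_mul, Finset.mul_sum]
      simp only [key, mul_add, Finset.sum_add_distrib]
      have h2 : ∀ j, (fun (_ : ι → ℂ) (x : κ → ℕ) => (x j : ℂ)) * (p * (q' j - q)) =
        p * ((fun _ x => (x j : ℂ)) * (q' j - q)) := fun j => by ring
      have h3 : ∀ j, (fun (_ : ι → ℂ) (x : κ → ℕ) => (x j : ℂ)) * ((p' j - p) * q) =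
        (fun _ x => (x j : ℂ)) * (p' j - p) * q := fun j => by ring
      simp only [h2, h3]
      ring
    rw [this]
    refine add_mem (sym_mul_mem hc hl hp.euler hq.mem (by linarith)) (add_mem
      (sym_mul_mem hc hl hp.mem hq.euler (by linarith)) (Submodule.sum_mem _ fun j _ => ?_))
    exact sym_mul_mem hc hl (polySym_le_sym _ _ (coord_mem_polySym j))
      (sym_mul_mem hc hl (hp.diff j) (hq.diff j) le_rfl) (by linarith)

/-- A symbol that does not change has degree `0`. -/
lemma EulerSym.of_mem {K : ℕ} {d : ℤ} {q : (ι → ℂ) → (κ → ℕ) → ℂ} (hq : q ∈ sym c l K d) :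
    EulerSym c l K d (fun _ => 0) q (fun _ => q) := by
  refine ⟨hq, fun j => by simp, ?_⟩
  have : (fun (_ : ι → ℂ) (_ : κ → ℕ) => (0 : ℂ)) = 0 := rfl
  simp [this]

lemma EulerSym.one (K : ℕ) : EulerSym c l K 0 (fun _ => 0) 1 (fun _ => 1) :=
  EulerSym.of_mem (polySym_le_sym _ _ (entire_mem_polySym (differentiable_const 1)))

lemma EulerSym.prod (hc : ∀ i, 0 < c i) (hl : ∀ i j, 0 < l i j) {K : ℕ} {A : Type*}
    (S : Finset A) {d : A → ℤ} {θ : A → (ι → ℂ) → ℂ} {q : A → (ι → ℂ) → (κ → ℕ) → ℂ}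
    {q' : A → κ → (ι → ℂ) → (κ → ℕ) → ℂ} (h : ∀ i, EulerSym c l K (d i) (θ i) (q i) (q' i)) :
    EulerSym c l K (∑ i ∈ S, d i) (fun s => ∑ i ∈ S, θ i s) (∏ i ∈ S, q i)
      (fun j => ∏ i ∈ S, q' i j) := by
  classical
  induction S using Finset.induction_on with
  | empty => simpa using EulerSym.one K
  | insert i S hi ih =>
    simp only [Finset.prod_insert hi, Finset.sum_insert hi]
    exact (h i).mul hc hl ih

lemma EulerSym.pow (hc : ∀ i, 0 < c i) (hl : ∀ i j, 0 < l i j) {K : ℕ} {d : ℤ}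
    {θ : (ι → ℂ) → ℂ} {q : (ι → ℂ) → (κ → ℕ) → ℂ} {q' : κ → (ι → ℂ) → (κ → ℕ) → ℂ}
    (h : EulerSym c l K d θ q q') (n : ℕ) :
    EulerSym c l K (n * d) (fun s => n * θ s) (q ^ n) (fun j => q' j ^ n) := by
  simpa using EulerSym.prod hc hl (Finset.range n) fun _ => h

lemma eulerSym_coord [DecidableEq κ] (K : ℕ) (k : κ) :
    EulerSym c l K 1 (fun _ => 1) (fun _ x => (x k : ℂ))
      (fun j _ x => (((x + Pi.single j 1 : κ → ℕ) k : ℕ) : ℂ)) := by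
  have h : ∀ j, (fun (_ : ι → ℂ) (x : κ → ℕ) => (((x + Pi.single j 1 : κ → ℕ) k : ℕ) : ℂ)) -
      (fun _ x => (x k : ℂ)) = fun _ _ => if k = j then 1 else 0 := by
    intro j
    funext s x
    simp [Pi.single_apply]
  refine ⟨polySym_le_sym _ _ (coord_mem_polySym k), fun j => ?_, ?_⟩
  · rw [h]
    exact polySym_le_sym _ _ (entire_mem_polySym (differentiable_const _))
  · simp only [h]
    refine (congrArg (· ∈ _) ?_).mp (zero_mem (sym c l K (1 - 1)))
    funext s x
    simp [Finset.sum_apply]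

lemma eulerSym_shiftFactor (hc : ∀ i, 0 < c i) (hl : ∀ i j, 0 < l i j) {z : (ι → ℂ) → ℂ}
    (hz : Differentiable ℂ z) (K : ℕ) (i : ι) :
    EulerSym c l K 0 (fun s => -z s) 1 (fun j => shiftFactor c l z i j) := by
  have hmain : ∀ a : ℂ, (fun s x => -z s * (a * (affineForm (c i) (l i) x : ℂ)⁻¹)) ∈
      sym c l K (-1) := by
    intro a
    have h := polySym_mul_mem (entire_mem_polySym (c := c) (l := l) (hz.neg.mul_const a))
      (inv_affineForm_mem_polySym (c := c) (l := l) i)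
    refine polySym_le_sym _ _ (polySym_mono (by norm_num) ((congrArg (· ∈ _) ?_).mp h))
    funext s x
    simp
    ring
  have hfac := fun j => shiftFactor_sub_mem hc hl hz K i j
  refine ⟨polySym_le_sym _ _ (entire_mem_polySym (differentiable_const 1)), fun j => ?_, ?_⟩
  · have := add_mem (sym_mono K (by norm_num : (-2 : ℤ) ≤ 0 - 1) (hfac j)) (hmain (l i j))
    simpa using this
  · have h1 : ∑ j, (fun _ x => (x j : ℂ)) * (shiftFactor c l z i j - 1 -
        (fun s x => -z s * (l i j * (affineForm (c i) (l i) x : ℂ)⁻¹))) ∈ sym c l K (-1) :=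
      Submodule.sum_mem _ fun j _ => sym_mul_mem hc hl
        (polySym_le_sym _ _ (coord_mem_polySym j)) (hfac j) (by norm_num)
    have h2 := add_mem h1 (hmain (-c i))
    refine (congrArg (· ∈ _) ?_).mp h2
    funext s x
    have hne : (affineForm (c i) (l i) x : ℂ) ≠ 0 := by
      exact_mod_cast (affineForm_pos (hc i) (hl i) x).ne'
    have hsum : ∑ j, (x j : ℂ) * (l i j : ℂ) = affineForm (c i) (l i) x - c i := by
      simp [affineForm, mul_comm]
    simp only [Pi.add_apply, Finset.sum_apply, Pi.mul_apply, Pi.sub_apply, Pi.one_apply]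
    have h3 : ∀ j, (x j : ℂ) * (shiftFactor c l z i j s x - 1 -
        -z s * (l i j * (affineForm (c i) (l i) x : ℂ)⁻¹)) =
        (x j : ℂ) * (shiftFactor c l z i j s x - 1) +
          z s * (affineForm (c i) (l i) x : ℂ)⁻¹ * ((x j : ℂ) * l i j) := fun j => by ring
    simp only [h3, Finset.sum_add_distrib]
    rw [← Finset.mul_sum, hsum]
    field_simp
    ring

/-- The symbol `q'` for which `∏ ℓ_i(x) ^ (-s_i) * q'` is the translate of
`∏ ℓ_i(x) ^ (-s_i) * e(s) * monom a b` by the `j`-th unit vector. -/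
noncomputable def shiftedMonom [DecidableEq κ] (c : ι → ℝ) (l : ι → κ → ℝ) (e : (ι → ℂ) → ℂ)
    (a : ι → ℕ) (b : κ → ℕ) (j : κ) : (ι → ℂ) → (κ → ℕ) → ℂ := fun s x =>
  e s * monom c l a b s (x + Pi.single j 1) * ∏ i, shiftFactor c l (fun s => s i) i j s x

lemma affineForm_add_single [DecidableEq κ] (c : ℝ) (l : κ → ℝ) (x : κ → ℕ) (j : κ) :
    affineForm c l (x + Pi.single j 1) = affineForm c l x + l j := by
  simp only [affineForm, Pi.add_apply, Nat.cast_add, mul_add, Finset.sum_add_distrib]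
  simp [Pi.single_apply, add_assoc]

lemma eulerSym_monom [DecidableEq κ] (hc : ∀ i, 0 < c i) (hl : ∀ i j, 0 < l i j) (K : ℕ)
    {e : (ι → ℂ) → ℂ} (he : Differentiable ℂ e) (a : ι → ℕ) (b : κ → ℕ) :
    EulerSym c l K (∑ j, (b j : ℤ) - ∑ i, (a i : ℤ))
      (fun s => ((∑ j, (b j : ℤ) - ∑ i, (a i : ℤ) : ℤ) : ℂ) - ∑ i, s i)
      ((fun s _ => e s) * monom c l a b) (shiftedMonom c l e a b) := by
  have h0 : EulerSym c l K 0 (fun _ => 0) (fun s _ => e s) (fun _ s _ => e s) :=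
    EulerSym.of_mem (polySym_le_sym _ _ (entire_mem_polySym he))
  have h1 := EulerSym.prod hc hl Finset.univ fun k =>
    (eulerSym_coord (ι := ι) (κ := κ) (c := c) (l := l) K k).pow hc hl (b k)
  have h2 := EulerSym.prod hc hl Finset.univ fun i =>
    ((EulerSym.of_mem (polySym_le_sym K _
      (inv_affineForm_mem_polySym (c := c) (l := l) i))).mul hc hl
      (eulerSym_shiftFactor hc hl (differentiable_const 1) K i)).pow hc hl (a i)
  have h3 := EulerSym.prod hc hl Finset.univ fun i =>
    eulerSym_shiftFactor (z := fun s => s i) hc hl (differentiable_apply i) K i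
  convert (h0.mul hc hl (h1.mul hc hl h2)).mul hc hl h3 using 1
  · simp [sub_eq_add_neg]
  · funext s
    simp
    ring
  · rw [monom_eq]
    simp
  · funext j s x
    simp only [shiftedMonom, monom_eq, Pi.mul_apply, Finset.prod_apply, Pi.pow_apply]
    congr 3
    refine Finset.prod_congr rfl fun i _ => ?_
    congr 1
    rw [affineForm_add_single]
    have hne := (affineForm_pos (hc i) (hl i) x).ne'
    have hpos := affineForm_pos (hc i) (hl i) x
    have hlij := hl i j
    have hne2 : (affineForm (c i) (l i) x + l i j) ≠ 0 := by positivity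
    simp only [shiftFactor, Complex.cpow_neg_one]
    rw [← Complex.ofReal_inv, ← Complex.ofReal_inv, ← Complex.ofReal_one, ← Complex.ofReal_add,
      ← Complex.ofReal_inv, ← Complex.ofReal_mul]
    congr 1
    field_simp

end Euler

/-! ### Normally convergent series of entire functions on a complex normed space -/

section Holomorphic

variable {E : Type*} [NormedAddCommGroup E] [NormedSpace ℂ E]

/-- Cauchy's estimate, applied on complex lines. -/
lemma norm_fderiv_le_of_forall_mem_ball {f : E → ℂ} (hf : Differentiable ℂ f) {s : E} {r C : ℝ}
    (hr : 0 < r) (h : ∀ t ∈ Metric.closedBall s r, ‖f t‖ ≤ C) : ‖fderiv ℂ f s‖ ≤ C / r := by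
  have hC : 0 ≤ C := (norm_nonneg _).trans (h s (Metric.mem_closedBall_self hr.le))
  refine ContinuousLinearMap.opNorm_le_bound _ (by positivity) fun v => ?_
  rcases eq_or_ne v 0 with rfl | hv
  · simp
  have hv' : 0 < ‖v‖ := norm_pos_iff.2 hv
  have hg : ∀ z : ℂ, HasDerivAt (fun z : ℂ => s + z • v) v z := fun z => by
    simpa using ((hasDerivAt_id z).smul_const v).const_add s
  have hd : HasDerivAt (fun z : ℂ => f (s + z • v)) (fderiv ℂ f s v) 0 := by
    have h1 : HasFDerivAt f (fderiv ℂ f s) (s + (0 : ℂ) • v) := by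
      simpa using (hf s).hasFDerivAt
    exact h1.comp_hasDerivAt 0 (hg 0)
  have hdiff : Differentiable ℂ fun z : ℂ => f (s + z • v) :=
    hf.comp fun z => (hg z).differentiableAt
  have := Complex.norm_deriv_le_of_forall_mem_sphere_norm_le (c := 0) (R := r / ‖v‖) (C := C)
    (by positivity) hdiff.diffContOnCl fun z hz => h _ <| by
      rw [mem_sphere_zero_iff_norm] at hz
      rw [Metric.mem_closedBall, dist_eq_norm, add_sub_cancel_left, norm_smul, hz,
        div_mul_cancel₀ _ hv'.ne']
  rw [hd.deriv] at this
  calc _ ≤ C / (r / ‖v‖) := this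
    _ = _ := by field_simp

/-- A series of entire functions of several variables that converges normally, locally on a set, is
holomorphic there. -/
lemma differentiableAt_tsum_of_norm_le {A : Type*} {f : A → E → ℂ}
    (hf : ∀ a, Differentiable ℂ (f a)) {s : E} {r : ℝ} (hr : 0 < r) {u : A → ℝ}
    (hu : Summable u) (h : ∀ a, ∀ t ∈ Metric.ball s r, ‖f a t‖ ≤ u a) :
    DifferentiableAt ℂ (fun t => ∑' a, f a t) s := by
  have hs : s ∈ Metric.ball s (r / 2) := Metric.mem_ball_self (by positivity)
  refine (hasFDerivAt_tsum_of_isPreconnected (u := fun a => u a / (r / 2))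
    (f' := fun a t => fderiv ℂ (f a) t) (hu.div_const _) Metric.isOpen_ball
    ((convex_ball s (r / 2)).isPreconnected) (fun a t _ => (hf a t).hasFDerivAt)
    (fun a t ht => ?_) hs ?_ hs).differentiableAt
  · refine norm_fderiv_le_of_forall_mem_ball (hf a) (by positivity) fun t' ht' => h a t' ?_
    rw [Metric.mem_closedBall] at ht'
    rw [Metric.mem_ball] at ht ⊢
    linarith [dist_triangle t' t s]
  · exact Summable.of_norm_bounded hu fun a => h a s (Metric.mem_ball_self hr)

end Holomorphic

/-! ### Series of symbols in the domain of convergence -/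

section Summation

variable {ι κ : Type*} [Fintype ι] [Fintype κ]

lemma summable_size_rpow {r : ℝ} (hr : (Fintype.card κ : ℝ) < r) :
    Summable fun x : κ → ℕ => size x ^ (-r) := by
  classical
  rcases isEmpty_or_nonempty κ with hκ | hκ
  · exact Summable.of_finite
  have hm : (0 : ℝ) < Fintype.card κ := by exact_mod_cast Fintype.card_pos
  set m : ℝ := (Fintype.card κ : ℝ) with hm'
  have hr0 : 0 < r := hm.trans hr
  have h1 : Summable fun k : ℕ => ((k : ℝ) + 1) ^ (-(r / m)) := by
    have := (Real.summable_nat_rpow (p := -(r / m))).2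
      (by rw [neg_lt_neg_iff, lt_div_iff₀ hm]; linarith)
    simpa using (summable_nat_add_iff 1).2 this
  have h0 : ∀ k : ℕ, 0 ≤ ((k : ℝ) + 1) ^ (-(r / m)) := fun k => by positivity
  refine Summable.of_nonneg_of_le (f := fun x : κ → ℕ => ∏ j, ((x j : ℝ) + 1) ^ (-(r / m)))
    (fun x => Real.rpow_nonneg (size_pos x).le _) (fun x => ?_) ?_
  · calc size x ^ (-r) = ∏ _j : κ, size x ^ (-(r / m)) := by
          rw [Finset.prod_const, Finset.card_univ, ← Real.rpow_natCast,
            ← Real.rpow_mul (size_pos x).le, ← hm']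
          congr 1
          field_simp
      _ ≤ _ := Finset.prod_le_prod (fun j _ => Real.rpow_nonneg (size_pos x).le _) fun j _ =>
          Real.rpow_le_rpow_of_nonpos (by positivity) (coord_le_size x j)
            (by rw [neg_nonpos]; positivity)
  · refine summable_of_sum_le (c := ∏ _j : κ, ∑' k : ℕ, ((k : ℝ) + 1) ^ (-(r / m)))
      (fun x => Finset.prod_nonneg fun j _ => h0 _) fun u => ?_
    have hsub : u ⊆ Fintype.piFinset fun j => u.image fun x => x j := by
      intro x hx
      rw [Fintype.mem_piFinset]
      exact fun j => Finset.mem_image_of_mem _ hx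
    refine (Finset.sum_le_sum_of_subset_of_nonneg hsub
      fun x _ _ => Finset.prod_nonneg fun j _ => h0 _).trans ?_
    rw [← Finset.prod_univ_sum (fun j => u.image fun x => x j)
      fun (_ : κ) (k : ℕ) => ((k : ℝ) + 1) ^ (-(r / m))]
    exact Finset.prod_le_prod (fun j _ => Finset.sum_nonneg fun k _ => h0 k)
      fun j _ => h1.sum_le_tsum _ fun k _ => h0 k

variable (c : ι → ℝ) (l : ι → κ → ℝ)

/-- The product `∏ i, ℓ_i(x) ^ (-s_i)`. -/
noncomputable def powProd (s : ι → ℂ) (x : κ → ℕ) : ℂ :=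
  ∏ i, (affineForm (c i) (l i) x : ℂ) ^ (-s i)

variable {c l}

lemma differentiable_powProd (hc : ∀ i, 0 < c i) (hl : ∀ i j, 0 < l i j) (x : κ → ℕ) :
    Differentiable ℂ fun s => powProd c l s x := by
  classical
  intro s
  have h : ∀ i, DifferentiableAt ℂ
      (fun s : ι → ℂ => (affineForm (c i) (l i) x : ℂ) ^ (-s i)) s := fun i => by
    refine DifferentiableAt.const_cpow (differentiable_apply i s).neg (Or.inl ?_)
    exact_mod_cast (affineForm_pos (hc i) (hl i) x).ne'
  exact (HasFDerivAt.finsetProd (u := Finset.univ) fun i _ => (h i).hasFDerivAt).differentiableAt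

lemma exists_norm_powProd_le (hc : ∀ i, 0 < c i) (hl : ∀ i j, 0 < l i j) (R : ℝ) :
    ∃ C : ℝ, 0 ≤ C ∧ ∀ s : ι → ℂ, ‖s‖ ≤ R → ∀ x,
      ‖powProd c l s x‖ ≤ C * size x ^ (-(∑ i, s i).re) := by
  choose A hA hcomp using fun i => exists_affineForm_comparable (hc i) (hl i)
  refine ⟨∏ i, A i ^ R, Finset.prod_nonneg fun i _ =>
    Real.rpow_nonneg (zero_le_one.trans (hA i)) _, fun s hs x => ?_⟩
  have hsz := size_pos x
  have h : size x ^ (-(∑ i, s i).re) = ∏ i, size x ^ (-(s i).re) := by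
    rw [← Real.rpow_sum_of_pos hsz, Complex.re_sum, Finset.sum_neg_distrib]
  rw [powProd, norm_prod, h, ← Finset.prod_mul_distrib]
  refine Finset.prod_le_prod (fun i _ => norm_nonneg _) fun i _ => ?_
  have hpos := affineForm_pos (hc i) (hl i) x
  have hA0 : 0 < A i := zero_lt_one.trans_le (hA i)
  rw [Complex.norm_cpow_eq_rpow_re_of_pos hpos, Complex.neg_re]
  have hre : |(s i).re| ≤ R := (Complex.abs_re_le_norm _).trans ((norm_le_pi_norm s i).trans hs)
  rcases le_total 0 (-(s i).re) with h0 | h0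
  · calc _ ≤ (A i * size x) ^ (-(s i).re) := Real.rpow_le_rpow hpos.le (hcomp i x).1 h0
      _ = A i ^ (-(s i).re) * size x ^ (-(s i).re) := Real.mul_rpow hA0.le hsz.le
      _ ≤ _ := mul_le_mul_of_nonneg_right (Real.rpow_le_rpow_of_exponent_le (hA i)
          ((neg_le_abs _).trans hre)) (Real.rpow_nonneg hsz.le _)
  · have h1 : (A i)⁻¹ * size x ≤ affineForm (c i) (l i) x := by
      rw [inv_mul_le_iff₀ hA0]
      exact (hcomp i x).2
    calc _ ≤ ((A i)⁻¹ * size x) ^ (-(s i).re) :=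
          Real.rpow_le_rpow_of_nonpos (by positivity) h1 h0
      _ = A i ^ (s i).re * size x ^ (-(s i).re) := by
          rw [Real.mul_rpow (inv_nonneg.2 hA0.le) hsz.le, Real.inv_rpow hA0.le,
            Real.rpow_neg hA0.le, inv_inv]
      _ ≤ _ := mul_le_mul_of_nonneg_right (Real.rpow_le_rpow_of_exponent_le (hA i)
          ((le_abs_self _).trans hre)) (Real.rpow_nonneg hsz.le _)

/-- The series of a bounded symbol of order `d` converges normally for `Re (∑ s_i) > m + d`. -/
lemma exists_summable_bound (hc : ∀ i, 0 < c i) (hl : ∀ i j, 0 < l i j) {d : ℤ}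
    {q : (ι → ℂ) → (κ → ℕ) → ℂ} (hq : q ∈ boundedSym ι κ d) (R : ℝ) {B : ℝ}
    (hB : (Fintype.card κ : ℝ) + d < B) :
    ∃ u : (κ → ℕ) → ℝ, Summable u ∧ ∀ s : ι → ℂ, ‖s‖ ≤ R → B ≤ (∑ i, s i).re → ∀ x,
      ‖powProd c l s x * q s x‖ ≤ u x := by
  obtain ⟨C, hC0, hC⟩ := exists_norm_powProd_le hc hl R
  obtain ⟨D, hD0, hD⟩ := hq.2 R
  refine ⟨fun x => C * D * size x ^ (-(B - d)),
    (summable_size_rpow (by linarith)).mul_left _, fun s hs hBs x => ?_⟩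
  have hsz := size_pos x
  rw [norm_mul]
  calc _ ≤ (C * size x ^ (-(∑ i, s i).re)) * (D * size x ^ d) :=
        mul_le_mul (hC s hs x) (hD s hs x) (norm_nonneg _)
          (mul_nonneg hC0 (Real.rpow_nonneg hsz.le _))
    _ = C * D * size x ^ (-(∑ i, s i).re + d) := by
        rw [Real.rpow_add hsz, Real.rpow_intCast]
        ring
    _ ≤ _ := mul_le_mul_of_nonneg_left
        (Real.rpow_le_rpow_of_exponent_le (one_le_size x) (by linarith)) (by positivity)

lemma summable_powProd_mul (hc : ∀ i, 0 < c i) (hl : ∀ i j, 0 < l i j) {d : ℤ}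
    {q : (ι → ℂ) → (κ → ℕ) → ℂ} (hq : q ∈ boundedSym ι κ d) {s : ι → ℂ}
    (hs : (Fintype.card κ : ℝ) + d < (∑ i, s i).re) :
    Summable fun x => powProd c l s x * q s x := by
  obtain ⟨u, hu, h⟩ := exists_summable_bound hc hl hq ‖s‖ hs
  exact Summable.of_norm_bounded hu fun x => h s le_rfl le_rfl x

lemma differentiableOn_tsum_powProd_mul (hc : ∀ i, 0 < c i) (hl : ∀ i j, 0 < l i j) {d : ℤ}
    {q : (ι → ℂ) → (κ → ℕ) → ℂ} (hq : q ∈ boundedSym ι κ d) :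
    DifferentiableOn ℂ (fun s => ∑' x, powProd c l s x * q s x)
      {s | (Fintype.card κ : ℝ) + d < (∑ i, s i).re} := by
  intro s hs
  refine DifferentiableAt.differentiableWithinAt ?_
  obtain ⟨B, hB, hBs⟩ := exists_between (show (Fintype.card κ : ℝ) + d < (∑ i, s i).re from hs)
  obtain ⟨u, hu, h⟩ := exists_summable_bound hc hl hq (‖s‖ + 1) hB
  have hopen : IsOpen {t : ι → ℂ | B < (∑ i, t i).re} :=
    isOpen_lt continuous_const (by fun_prop)
  obtain ⟨r, hr, hball⟩ := Metric.isOpen_iff.1 hopen s hBs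
  refine differentiableAt_tsum_of_norm_le (r := min r 1)
    (fun x => (differentiable_powProd hc hl x).mul (hq.1 x)) (by positivity) hu
    fun x t ht => h t ?_ ?_ x
  · have h1 : dist t s < 1 := (Metric.mem_ball.1 ht).trans_le (min_le_right _ _)
    rw [dist_eq_norm] at h1
    linarith [norm_sub_norm_le t s]
  · exact le_of_lt (hball (Metric.ball_subset_ball (min_le_left _ _) ht))

end Summation

/-! ### Continuation of the several-variable zeta function -/

section Continuation

/-- Summation over `ℕ^κ` of a finite difference of a function that vanishes for `x_j = 0`. -/
lemma hasSum_sub_add_single {κ : Type*} [DecidableEq κ] {f : (κ → ℕ) → ℂ} (hf : Summable f) (j : κ)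
    (h0 : ∀ x, x j = 0 → f x = 0) : HasSum (fun x => f (x + Pi.single j 1) - f x) 0 := by
  have hinj : Function.Injective fun x : κ → ℕ => x + Pi.single j 1 := add_left_injective _
  have h := (hinj.hasSum_iff (f := f) (a := ∑' x, f x) fun x hx => h0 x ?_).2 hf.hasSum
  · simpa using h.sub hf.hasSum
  · by_contra hxj
    refine hx ⟨x - Pi.single j 1, ?_⟩
    refine tsub_add_cancel_of_le fun k => ?_
    rcases eq_or_ne k j with rfl | hk
    · simpa using Nat.one_le_iff_ne_zero.2 hxj
    · simp [hk]

variable {ι κ : Type*} [Fintype ι] [Fintype κ] {c : ι → ℝ} {l : ι → κ → ℝ}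

/-- The series `∑ x, q(s, x) ∏ ℓ_i(x) ^ (-s_i)`, divided by `Γ(∑ s_i - m - d)`, has a holomorphic
continuation to `Re (∑ s_i) > B`. The points where `1 / Γ(∑ s_i - m - d)` vanishes are the possible
poles for a symbol of order `d`. -/
def HasContinuation (c : ι → ℝ) (l : ι → κ → ℝ) (d : ℤ) (B : ℝ)
    (q : (ι → ℂ) → (κ → ℕ) → ℂ) : Prop :=
  ∃ W : (ι → ℂ) → ℂ, DifferentiableOn ℂ W {s | B < (∑ i, s i).re} ∧
    ∃ b : ℝ, ∀ s : ι → ℂ, b < (∑ i, s i).re → HasSum (fun x =>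
      (Complex.Gamma (∑ i, s i - Fintype.card κ - d))⁻¹ * (powProd c l s x * q s x)) (W s)

lemma HasContinuation.mono {d : ℤ} {B B' : ℝ} {q : (ι → ℂ) → (κ → ℕ) → ℂ} (hB : B ≤ B')
    (h : HasContinuation c l d B q) : HasContinuation c l d B' q := by
  obtain ⟨W, hW, b, hb⟩ := h
  exact ⟨W, hW.mono fun s hs => lt_of_le_of_lt hB hs, b, hb⟩

lemma HasContinuation.add {d : ℤ} {B : ℝ} {p q : (ι → ℂ) → (κ → ℕ) → ℂ}
    (hp : HasContinuation c l d B p) (hq : HasContinuation c l d B q) :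
    HasContinuation c l d B (p + q) := by
  obtain ⟨V, hV, a, ha⟩ := hp
  obtain ⟨W, hW, b, hb⟩ := hq
  refine ⟨fun s => V s + W s, hV.add hW, max a b, fun s hs => ?_⟩
  convert! (ha s ((le_max_left a b).trans_lt hs)).add (hb s ((le_max_right a b).trans_lt hs)) using 1
  funext x
  simp only [Pi.add_apply]
  ring

lemma HasContinuation.smul {d : ℤ} {B : ℝ} {q : (ι → ℂ) → (κ → ℕ) → ℂ} (a : ℂ)
    (hq : HasContinuation c l d B q) : HasContinuation c l d B (a • q) := by
  obtain ⟨W, hW, b, hb⟩ := hq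
  refine ⟨fun s => a * W s, hW.const_mul a, b, fun s hs => ?_⟩
  convert! (hb s hs).mul_left a using 1
  funext x
  simp only [Pi.smul_apply, smul_eq_mul]
  ring

lemma HasContinuation.zero (d : ℤ) (B : ℝ) : HasContinuation c l d B 0 :=
  ⟨fun _ => 0, differentiableOn_const 0, 0, fun s _ => by simp [hasSum_zero]⟩

lemma HasContinuation.succ_order {d : ℤ} {B : ℝ} {q : (ι → ℂ) → (κ → ℕ) → ℂ}
    (h : HasContinuation c l d B q) : HasContinuation c l (d + 1) B q := by
  obtain ⟨W, hW, b, hb⟩ := h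
  refine ⟨fun s => (∑ i, s i - Fintype.card κ - (d + 1)) * W s,
    DifferentiableOn.mul (Differentiable.differentiableOn (by fun_prop)) hW, b, fun s hs => ?_⟩
  convert! (hb s hs).mul_left (∑ i, s i - Fintype.card κ - (d + 1)) using 1
  funext x
  rw [Complex.one_div_Gamma_eq_self_mul_one_div_Gamma_add_one]
  push_cast
  rw [show ∑ i, s i - Fintype.card κ - (d + 1 : ℂ) + 1 = ∑ i, s i - Fintype.card κ - d by ring]
  ring

lemma HasContinuation.mono_order {d e : ℤ} (hde : d ≤ e) {B : ℝ}
    {q : (ι → ℂ) → (κ → ℕ) → ℂ} (h : HasContinuation c l d B q) : HasContinuation c l e B q := by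
  induction e, hde using Int.leInduction with
  | base => exact h
  | succ e _ ih => exact ih.succ_order

lemma hasContinuation_of_mem_boundedSym (hc : ∀ i, 0 < c i) (hl : ∀ i j, 0 < l i j) {d : ℤ}
    {q : (ι → ℂ) → (κ → ℕ) → ℂ} (hq : q ∈ boundedSym ι κ d) (e : ℤ) :
    HasContinuation c l e (Fintype.card κ + d) q := by
  refine ⟨fun s => (Complex.Gamma (∑ i, s i - Fintype.card κ - e))⁻¹ *
    ∑' x, powProd c l s x * q s x, ?_, Fintype.card κ + d, fun s hs => ?_⟩
  · refine DifferentiableOn.mul (Differentiable.differentiableOn ?_)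
      (differentiableOn_tsum_powProd_mul hc hl hq)
    exact Complex.differentiable_one_div_Gamma.comp (by fun_prop)
  · exact (summable_powProd_mul hc hl hq hs).hasSum.mul_left _

lemma powProd_add_single [DecidableEq κ] (hc : ∀ i, 0 < c i) (hl : ∀ i j, 0 < l i j) (s : ι → ℂ)
    (x : κ → ℕ) (j : κ) : powProd c l s (x + Pi.single j 1) =
      powProd c l s x * ∏ i, shiftFactor c l (fun s => s i) i j s x := by
  rw [powProd, powProd, ← Finset.prod_mul_distrib]
  refine Finset.prod_congr rfl fun i _ => ?_
  have hpos := affineForm_pos (hc i) (hl i) x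
  have hlij := hl i j
  have h : ((affineForm (c i) (l i) (x + Pi.single j 1) : ℝ) : ℂ) =
      (affineForm (c i) (l i) x : ℂ) * ((1 + l i j * (affineForm (c i) (l i) x)⁻¹ : ℝ) : ℂ) := by
    rw [affineForm_add_single, ← Complex.ofReal_mul]
    congr 1
    field_simp
  rw [h, Complex.mul_cpow_ofReal_nonneg hpos.le (by positivity), shiftFactor]
  push_cast
  rfl

/-- The step that pushes the continuation one unit to the left. Summing the finite differences of
`x_j ∏ ℓ_i(x) ^ (-s_i) q` gives `0`; by Euler's relation they add up to
`(m + d - ∑ s_i) ∏ ℓ_i(x) ^ (-s_i) q` and terms of lower order. -/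
lemma hasContinuation_monom_succ (hc : ∀ i, 0 < c i) (hl : ∀ i j, 0 < l i j) {K : ℕ}
    (ih : ∀ (d : ℤ), ∀ q ∈ polySym c l d, HasContinuation c l d (Fintype.card κ + d - K) q)
    {e : (ι → ℂ) → ℂ} (he : Differentiable ℂ e) (a : ι → ℕ) (b : κ → ℕ) {d : ℤ}
    (hd : d = ∑ j, (b j : ℤ) - ∑ i, (a i : ℤ)) :
    HasContinuation c l d (Fintype.card κ + d - (K + 1)) ((fun s _ => e s) * monom c l a b) := by
  classical
  have hE := eulerSym_monom hc hl K he a b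
  rw [← hd] at hE
  set q : (ι → ℂ) → (κ → ℕ) → ℂ := (fun s _ => e s) * monom c l a b with hq
  set q' := shiftedMonom c l e a b with hq'
  set low : (ι → ℂ) → (κ → ℕ) → ℂ := ∑ j, (fun _ x => (x j : ℂ)) * (q' j - q) -
    (fun s _ => (d : ℂ) - ∑ i, s i) * q + ∑ j, (q' j - q) with hlow
  have hlowmem : low ∈ sym c l K (d - 1) :=
    add_mem hE.euler (Submodule.sum_mem _ fun j _ => hE.diff j)
  have hlowcont : HasContinuation c l (d - 1) (Fintype.card κ + d - (K + 1)) low := by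
    obtain ⟨p₁, hp₁, p₂, hp₂, h⟩ := Submodule.mem_sup.1 hlowmem
    rw [← h]
    refine HasContinuation.add ((ih _ p₁ hp₁).mono ?_)
      ((hasContinuation_of_mem_boundedSym hc hl hp₂ _).mono ?_)
    · push_cast; linarith
    · push_cast; linarith
  obtain ⟨W, hW, b₀, hb₀⟩ := hlowcont
  have hqb : q ∈ boundedSym ι κ d :=
    polySym_le_boundedSym hc hl _ (entire_mul_monom_mem he a b hd.ge)
  refine ⟨W, hW, max b₀ (Fintype.card κ + (1 + d : ℤ)), fun s hs => ?_⟩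
  have hlowsum := hb₀ s ((le_max_left _ _).trans_lt hs)
  have htel : ∀ j, HasSum (fun x => powProd c l s x * (((x j : ℂ) + 1) * q' j s x - x j * q s x))
      0 := by
    intro j
    have h1 := boundedSym_mul_mem (coord_mem_boundedSym j) hqb
    have h2 := hasSum_sub_add_single
      (summable_powProd_mul hc hl h1 ((le_max_right _ _).trans_lt hs)) j fun x hx => by simp [hx]
    convert h2 using 1
    funext x
    rw [powProd_add_single hc hl]
    simp only [hq, hq', Pi.mul_apply, shiftedMonom, Pi.add_apply, Pi.single_eq_same, Nat.cast_add,
      Nat.cast_one]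
    ring
  have htel' := (hasSum_sum fun j (_ : j ∈ Finset.univ) => htel j).mul_left
    (Complex.Gamma (∑ i, s i - Fintype.card κ - (d - 1 : ℤ)))⁻¹
  simp only [Finset.sum_const_zero, mul_zero] at htel'
  convert! hlowsum.sub htel' using 1
  · funext x
    rw [Complex.one_div_Gamma_eq_self_mul_one_div_Gamma_add_one,
      show ∑ i, s i - Fintype.card κ - (d : ℂ) + 1 = ∑ i, s i - Fintype.card κ - (d - 1 : ℤ) by
        push_cast; ring, ← Finset.mul_sum]
    have hpt : ∑ j, (((x j : ℂ) + 1) * q' j s x - x j * q s x) =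
        low s x + (Fintype.card κ + d - ∑ i, s i) * q s x := by
      simp only [hlow, Pi.add_apply, Pi.sub_apply, Finset.sum_apply, Pi.mul_apply]
      have h3 : ∀ j, (((x j : ℂ) + 1) * q' j s x - x j * q s x) =
          (x j : ℂ) * (q' j s x - q s x) + (q' j s x - q s x) + q s x := fun j => by ring
      simp only [h3, Finset.sum_add_distrib, Finset.sum_const, Finset.card_univ, nsmul_eq_mul]
      ring
    rw [hpt]
    ring
  · simp

lemma hasContinuation_of_mem_polySym (hc : ∀ i, 0 < c i) (hl : ∀ i j, 0 < l i j) (K : ℕ) :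
    ∀ (d : ℤ), ∀ q ∈ polySym c l d, HasContinuation c l d (Fintype.card κ + d - K) q := by
  induction K with
  | zero =>
    intro d q hq
    simpa using hasContinuation_of_mem_boundedSym hc hl (polySym_le_boundedSym hc hl d hq) d
  | succ K ih =>
    intro d q hq
    induction hq using Submodule.span_induction with
    | mem q hq =>
      obtain ⟨e, a, b, he, hab, rfl⟩ := hq
      refine ((hasContinuation_monom_succ hc hl ih he a b rfl).mono_order hab).mono ?_
      have : (((∑ j, (b j : ℤ) - ∑ i, (a i : ℤ) : ℤ)) : ℝ) ≤ d := by exact_mod_cast hab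
      push_cast at this ⊢
      linarith
    | zero => exact HasContinuation.zero _ _
    | add p q _ _ hp hq => exact hp.add hq
    | smul a q _ hq => exact hq.smul a

/-- The several-variable zeta function `∑ x, ∏ ℓ_i(x) ^ (-s_i)` divided by `Γ(∑ s_i - m)` continues
holomorphically to every half-space. -/
theorem exists_continuation (hc : ∀ i, 0 < c i) (hl : ∀ i j, 0 < l i j) (B : ℝ) :
    ∃ W : (ι → ℂ) → ℂ, DifferentiableOn ℂ W {s | B < (∑ i, s i).re} ∧
      ∃ b : ℝ, ∀ s : ι → ℂ, b < (∑ i, s i).re → HasSum (fun x =>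
        (Complex.Gamma (∑ i, s i - Fintype.card κ))⁻¹ * powProd c l s x) (W s) := by
  obtain ⟨K, hK⟩ := exists_nat_ge (Fintype.card κ - B)
  obtain ⟨W, hW, b, hb⟩ := (hasContinuation_of_mem_polySym hc hl K 0 _
    (entire_mem_polySym (differentiable_const 1))).mono (B' := B) (by push_cast; linarith)
  exact ⟨W, hW, b, fun s hs => by simpa using hb s hs⟩

end Continuation

/-! ### The power series of `(1 - e^(c t)) / t` -/

section ExpQuot

variable {K : Type*} [Field K] [CharZero K]

/-- The power series of `(1 - e^(c t)) / t`. -/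
noncomputable def expQuot (c : K) : PowerSeries K :=
  PowerSeries.mk fun k => -c ^ (k + 1) / ((k + 1).factorial : K)

lemma X_mul_expQuot (c : K) :
    PowerSeries.X * expQuot c = 1 - PowerSeries.rescale c (PowerSeries.exp K) := by
  ext k
  cases k with
  | zero =>
    simp only [PowerSeries.coeff_zero_X_mul, map_sub, PowerSeries.coeff_rescale,
      PowerSeries.coeff_exp]
    simp
  | succ k =>
    rw [PowerSeries.coeff_succ_X_mul]
    simp [expQuot, PowerSeries.coeff_one, PowerSeries.coeff_exp, div_eq_mul_inv]

omit [CharZero K] in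
lemma constantCoeff_expQuot (c : K) : PowerSeries.constantCoeff (expQuot c) = -c := by
  rw [← PowerSeries.coeff_zero_eq_constantCoeff_apply]
  simp [expQuot]

end ExpQuot

/-! ### Asymptotic expansions at `0` from the right -/

section Expansion

open Asymptotics Filter Topology

/-- The power series `p` is the asymptotic expansion of `f` at `0` from the right. -/
def HasExpansion (f : ℝ → ℝ) (p : PowerSeries ℝ) : Prop :=
  ∀ N : ℕ, (fun t => f t - (p.trunc N).eval t) =O[𝓝[>] 0] fun t : ℝ => t ^ N

lemma isBigO_eval_of_X_pow_dvd {P : Polynomial ℝ} {N : ℕ} (h : Polynomial.X ^ N ∣ P) :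
    (fun t => P.eval t) =O[𝓝[>] 0] fun t : ℝ => t ^ N := by
  obtain ⟨Q, rfl⟩ := h
  have hQ : (fun t => Q.eval t) =O[𝓝[>] 0] fun _ : ℝ => (1 : ℝ) :=
    (Q.continuous.tendsto 0 |>.mono_left nhdsWithin_le_nhds).isBigO_one ℝ
  simpa using (isBigO_refl (fun t : ℝ => t ^ N) (𝓝[>] 0)).mul hQ

lemma hasExpansion_polynomial (P : Polynomial ℝ) : HasExpansion (fun t => P.eval t) P := by
  intro N
  have h : Polynomial.X ^ N ∣ P - PowerSeries.trunc N (P : PowerSeries ℝ) := by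
    rw [Polynomial.X_pow_dvd_iff]
    intro d hd
    simp [PowerSeries.coeff_trunc, hd]
  simpa using isBigO_eval_of_X_pow_dvd h

lemma HasExpansion.isBigO_one {f : ℝ → ℝ} {p : PowerSeries ℝ} (h : HasExpansion f p) :
    f =O[𝓝[>] 0] fun _ => (1 : ℝ) := by
  simpa using h 0

lemma HasExpansion.tendsto {f : ℝ → ℝ} {p : PowerSeries ℝ} (h : HasExpansion f p) :
    Tendsto f (𝓝[>] 0) (𝓝 (PowerSeries.constantCoeff p)) := by
  have h1 : Tendsto (fun t => f t - (p.trunc 1).eval t) (𝓝[>] 0) (𝓝 0) := by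
    refine (h 1).trans_tendsto ?_
    simp only [pow_one]
    exact tendsto_id.mono_left nhdsWithin_le_nhds
  have h2 : ∀ t : ℝ, (p.trunc 1).eval t = PowerSeries.constantCoeff p := fun t => by
    rw [PowerSeries.trunc_one_left]; simp
  simp only [h2] at h1
  simpa using h1.add_const (PowerSeries.constantCoeff p)

lemma HasExpansion.mul {f g : ℝ → ℝ} {p q : PowerSeries ℝ} (hf : HasExpansion f p)
    (hg : HasExpansion g q) : HasExpansion (fun t => f t * g t) (p * q) := by
  intro N
  have h : Polynomial.X ^ N ∣ p.trunc N * q.trunc N - PowerSeries.trunc N (p * q) := by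
    rw [Polynomial.X_pow_dvd_iff]
    intro d hd
    rw [Polynomial.coeff_sub, PowerSeries.coeff_trunc, if_pos hd,
      PowerSeries.coeff_mul_eq_coeff_trunc_mul_trunc p q hd, sub_eq_zero,
      ← Polynomial.coeff_coe, Polynomial.coe_mul]
  have h1 := (hf N).mul hg.isBigO_one
  have h2 := (hasExpansion_polynomial (p.trunc N)).isBigO_one.mul (hg N)
  have h3 := isBigO_eval_of_X_pow_dvd h
  simp only [mul_one, one_mul] at h1 h2
  refine ((h1.add h2).add h3).congr_left fun t => ?_
  simp only [Polynomial.eval_sub, Polynomial.eval_mul]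
  ring

lemma HasExpansion.inv {f : ℝ → ℝ} {p : PowerSeries ℝ} (hf : HasExpansion f p)
    (hp : PowerSeries.constantCoeff p ≠ 0) : HasExpansion (fun t => (f t)⁻¹) p⁻¹ := by
  intro N
  have hlim := hf.tendsto
  have hne : ∀ᶠ t in 𝓝[>] 0, f t ≠ 0 := hlim.eventually_ne hp
  have hinv : (fun t => (f t)⁻¹) =O[𝓝[>] 0] fun _ => (1 : ℝ) := (hlim.inv₀ hp).isBigO_one ℝ
  have h1 := hf.mul (hasExpansion_polynomial (p⁻¹.trunc N)) N
  have h2 : PowerSeries.trunc N (p * (p⁻¹.trunc N : PowerSeries ℝ)) = PowerSeries.trunc N 1 := by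
    ext d
    rw [PowerSeries.coeff_trunc, PowerSeries.coeff_trunc]
    split_ifs with hd
    · rw [← PowerSeries.mul_inv_cancel p hp, PowerSeries.coeff_mul_eq_coeff_trunc_mul_trunc p _ hd,
        PowerSeries.coeff_mul_eq_coeff_trunc_mul_trunc p p⁻¹ hd, PowerSeries.trunc_trunc]
    · rfl
  rw [h2] at h1
  have h3 := hasExpansion_polynomial 1 N
  simp only [Polynomial.coe_one] at h3
  refine ((hinv.mul (h1.sub h3)).neg_left).congr' ?_ (by simp)
  filter_upwards [hne] with t ht
  simp only [Polynomial.eval_one]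
  field_simp
  ring

lemma HasExpansion.prod {A : Type*} (S : Finset A) {f : A → ℝ → ℝ} {p : A → PowerSeries ℝ}
    (h : ∀ i ∈ S, HasExpansion (f i) (p i)) :
    HasExpansion (fun t => ∏ i ∈ S, f i t) (∏ i ∈ S, p i) := by
  classical
  induction S using Finset.induction_on with
  | empty => simpa using hasExpansion_polynomial 1
  | insert i S hi ih =>
    simp only [Finset.prod_insert hi]
    exact (h i (by simp)).mul (ih fun j hj => h j (by simp [hj]))

lemma eval_trunc (p : PowerSeries ℝ) (N : ℕ) (t : ℝ) :
    (p.trunc N).eval t = ∑ i ∈ Finset.range N, PowerSeries.coeff i p * t ^ i := by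
  simpa using PowerSeries.eval₂_trunc_eq_sum_range t (RingHom.id ℝ) N p

lemma hasExpansion_exp (c : ℝ) :
    HasExpansion (fun t => Real.exp (c * t)) (PowerSeries.rescale c (PowerSeries.exp ℝ)) := by
  intro N
  have h1 : Tendsto (fun t : ℝ => c * t) (𝓝[>] 0) (𝓝 0) := by
    have : Tendsto (fun t : ℝ => c * t) (𝓝 0) (𝓝 (c * 0)) :=
      (continuous_const.mul continuous_id).tendsto 0
    rw [mul_zero] at this
    exact this.mono_left nhdsWithin_le_nhds
  have h2 := (Real.exp_sub_sum_range_isBigO_pow N).comp_tendsto h1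
  have h3 : (fun t : ℝ => (c * t) ^ N) =O[𝓝[>] 0] fun t : ℝ => t ^ N := by
    simp only [mul_pow]
    exact (isBigO_refl _ _).const_mul_left _
  refine (h2.trans h3).congr_left fun t => ?_
  simp only [Function.comp_apply, eval_trunc]
  congr 1
  refine Finset.sum_congr rfl fun i _ => ?_
  simp [PowerSeries.coeff_exp]
  ring

lemma hasExpansion_expQuot (c : ℝ) :
    HasExpansion (fun t => (1 - Real.exp (c * t)) / t) (expQuot c) := by
  intro N
  have h := (hasExpansion_exp c (N + 1)).neg_left.mul (isBigO_refl (fun t : ℝ => t⁻¹) (𝓝[>] 0))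
  refine h.congr' ?_ ?_
  · filter_upwards [self_mem_nhdsWithin] with t ht
    have ht0 : t ≠ 0 := (Set.mem_Ioi.1 ht).ne'
    rw [eval_trunc, eval_trunc, Finset.sum_range_succ']
    have : ∀ i ∈ Finset.range N, PowerSeries.coeff (i + 1)
        (PowerSeries.rescale c (PowerSeries.exp ℝ)) * t ^ (i + 1) =
        -(PowerSeries.coeff i (expQuot c) * t ^ i) * t := by
      intro i _
      simp [expQuot, PowerSeries.coeff_exp]
      ring
    rw [Finset.sum_congr rfl this, ← Finset.sum_mul, Finset.sum_neg_distrib]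
    simp
    field_simp
    ring
  · filter_upwards [self_mem_nhdsWithin] with t ht
    have ht0 : t ≠ 0 := (Set.mem_Ioi.1 ht).ne'
    rw [pow_succ, mul_assoc, mul_inv_cancel₀ ht0, mul_one]

end Expansion

/-! ### The Barnes zeta function, by Mellin transform -/

section Barnes

open Asymptotics Filter Topology MeasureTheory

lemma hasSum_pi_prod {m : ℕ} {f : Fin m → ℕ → ℝ} {S : Fin m → ℝ} (h0 : ∀ j k, 0 ≤ f j k)
    (h : ∀ j, HasSum (f j) (S j)) :
    HasSum (fun x : Fin m → ℕ => ∏ j, f j (x j)) (∏ j, S j) := by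
  induction m with
  | zero => simp
  | succ m ih =>
    have h1 := ih (f := fun j => f j.succ) (fun j k => h0 _ k) fun j => h j.succ
    have hs := (h 0).summable.mul_of_nonneg h1.summable (fun k => h0 0 k)
      fun x => Finset.prod_nonneg fun j _ => h0 _ _
    have h2 := (h 0).mul h1 hs
    rw [← Fin.prod_univ_succ (f := S)] at h2
    rw [← (Fin.consEquiv fun _ : Fin (m + 1) => ℕ).hasSum_iff]
    convert! h2 using 1
    funext y
    simp [Fin.prod_univ_succ, Fin.consEquiv]

/-- The sum `e^(-c t) / ∏ (1 - e^(-l_j t))` of the exponentials `e^(-ℓ(x) t)` over `x ∈ ℕ^m`. -/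
noncomputable def expSum {m : ℕ} (c : ℝ) (l : Fin m → ℝ) (t : ℝ) : ℝ :=
  Real.exp (-c * t) * ∏ j, (1 - Real.exp (-l j * t))⁻¹

variable {m : ℕ} {c : ℝ} {l : Fin m → ℝ}

lemma hasSum_exp_affineForm (hl : ∀ j, 0 < l j) {t : ℝ} (ht : 0 < t) :
    HasSum (fun x : Fin m → ℕ => Real.exp (-affineForm c l x * t)) (expSum c l t) := by
  have h := (hasSum_pi_prod (f := fun j k => Real.exp (-l j * t) ^ k)
    (fun j k => pow_nonneg (Real.exp_pos _).le k) fun j => hasSum_geometric_of_lt_one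
      (Real.exp_pos _).le (Real.exp_lt_one_iff.2 (by have := hl j; nlinarith))).mul_left
      (Real.exp (-c * t))
  convert! h using 1
  funext x
  rw [affineForm]
  simp only [← Real.exp_nat_mul]
  rw [← Real.exp_sum, ← Real.exp_add]
  congr 1
  rw [neg_add, add_mul, ← Finset.sum_neg_distrib, Finset.sum_mul]
  congr 1
  exact Finset.sum_congr rfl fun j _ => by ring

/-- The power series of `t^m e^(y t) / ∏ (1 - e^(x_j t))`. It is meaningful when no `x_j` is zero. -/
noncomputable def todd {K : Type*} [Field K] [CharZero K] {m : ℕ} (y : K) (x : Fin m → K) :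
    PowerSeries K :=
  PowerSeries.rescale y (PowerSeries.exp K) * ∏ j, (expQuot (x j))⁻¹

lemma hasExpansion_todd (hl : ∀ j, 0 < l j) :
    HasExpansion (fun t => Real.exp (-c * t) * ∏ j, ((1 - Real.exp (-l j * t)) / t)⁻¹)
      (todd (-c) fun j => -l j) := by
  refine (hasExpansion_exp (-c)).mul (HasExpansion.prod Finset.univ fun j _ => ?_)
  refine (hasExpansion_expQuot (-l j)).inv ?_
  rw [constantCoeff_expQuot]
  simpa using (hl j).ne'

/-- The coefficients of the expansion of `t^m e^t e^(-c t) / ∏ (1 - e^(-l_j t))`. -/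
noncomputable def polarCoeff (c : ℝ) (l : Fin m → ℝ) (i : ℕ) : ℝ :=
  PowerSeries.coeff i (PowerSeries.rescale 1 (PowerSeries.exp ℝ) * todd (-c) fun j => -l j)

/-- What remains of `expSum` when `∑_{i ≤ m} polarCoeff i * t^(i - m) * e^(-t)` is taken away. -/
noncomputable def expSumRem (c : ℝ) (l : Fin m → ℝ) (t : ℝ) : ℝ :=
  expSum c l t - ∑ i ∈ Finset.range (m + 1),
    polarCoeff c l i * (t ^ ((i : ℝ) - m) * Real.exp (-t))

lemma expSumRem_isBigO_zero (hl : ∀ j, 0 < l j) :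
    expSumRem c l =O[𝓝[>] 0] fun t : ℝ => t ^ (-(-1) : ℝ) := by
  have h1 := ((hasExpansion_exp 1).mul (hasExpansion_todd (c := c) hl)) (m + 1)
  have h2 : (fun t : ℝ => Real.exp (-t)) =O[𝓝[>] 0] fun _ => (1 : ℝ) :=
    ((Real.continuous_exp.comp continuous_neg).tendsto 0 |>.mono_left
      nhdsWithin_le_nhds).isBigO_one ℝ
  have h3 := (h1.mul h2).mul (isBigO_refl (fun t : ℝ => t ^ (-(m : ℝ))) (𝓝[>] 0))
  refine h3.congr' ?_ ?_
  · filter_upwards [self_mem_nhdsWithin] with t ht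
    have ht0 : 0 < t := ht
    have hexp : Real.exp (1 * t) * Real.exp (-t) = 1 := by rw [← Real.exp_add]; simp
    have hprod : (∏ j, ((1 - Real.exp (-l j * t)) / t)⁻¹) * t ^ (-(m : ℝ)) =
        ∏ j, (1 - Real.exp (-l j * t))⁻¹ := by
      simp only [div_eq_mul_inv, mul_inv, inv_inv, Finset.prod_mul_distrib, Finset.prod_const,
        Finset.card_univ, Fintype.card_fin]
      rw [mul_assoc, Real.rpow_neg ht0.le, Real.rpow_natCast, mul_inv_cancel₀ (by positivity),
        mul_one]
    have hsum : (∑ i ∈ Finset.range (m + 1), polarCoeff c l i * t ^ i) * t ^ (-(m : ℝ)) =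
        ∑ i ∈ Finset.range (m + 1), polarCoeff c l i * t ^ ((i : ℝ) - m) := by
      rw [Finset.sum_mul]
      refine Finset.sum_congr rfl fun i _ => ?_
      rw [mul_assoc, ← Real.rpow_natCast t i, ← Real.rpow_add ht0, sub_eq_add_neg]
    rw [eval_trunc, expSumRem, expSum]
    change (_ - ∑ i ∈ Finset.range (m + 1), polarCoeff c l i * t ^ i) * _ * _ = _
    have h4 : ∑ i ∈ Finset.range (m + 1), polarCoeff c l i * (t ^ ((i : ℝ) - m) * Real.exp (-t)) =
        (∑ i ∈ Finset.range (m + 1), polarCoeff c l i * t ^ ((i : ℝ) - m)) * Real.exp (-t) := by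
      rw [Finset.sum_mul]
      exact Finset.sum_congr rfl fun i _ => by ring
    rw [h4, ← hsum, ← hprod]
    linear_combination Real.exp (-c * t) * (∏ j, ((1 - Real.exp (-l j * t)) / t)⁻¹) *
      t ^ (-(m : ℝ)) * hexp
  · filter_upwards [self_mem_nhdsWithin] with t ht
    have ht0 : 0 < t := ht
    rw [← Real.rpow_natCast, mul_one, ← Real.rpow_add ht0]
    congr 1
    push_cast
    ring

lemma one_sub_exp_pos (hl : ∀ j, 0 < l j) {t : ℝ} (ht : 0 < t) (j : Fin m) :
    0 < 1 - Real.exp (-l j * t) := by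
  have := (Real.exp_lt_one_iff (x := -l j * t)).2 (by have := hl j; nlinarith)
  linarith

lemma continuousOn_expSum (hl : ∀ j, 0 < l j) : ContinuousOn (expSum c l) (Set.Ioi 0) := by
  unfold expSum
  refine ContinuousOn.mul (Continuous.continuousOn (by fun_prop)) ?_
  refine continuousOn_finsetProd _ fun j _ => ContinuousOn.inv₀ (Continuous.continuousOn
    (by fun_prop)) fun t ht => (one_sub_exp_pos hl ht j).ne'

lemma continuousOn_polar (a : ℝ) :
    ContinuousOn (fun t : ℝ => t ^ a * Real.exp (-t)) (Set.Ioi 0) := by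
  refine ContinuousOn.mul (fun t ht => ?_) (Continuous.continuousOn (by fun_prop))
  exact (Real.continuousAt_rpow_const t a (Or.inl (Set.mem_Ioi.1 ht).ne')).continuousWithinAt

lemma continuousOn_expSumRem (hl : ∀ j, 0 < l j) : ContinuousOn (expSumRem c l) (Set.Ioi 0) := by
  unfold expSumRem
  exact (continuousOn_expSum hl).sub
    (continuousOn_finsetSum _ fun i _ => continuousOn_const.mul (continuousOn_polar _))

lemma expSum_isBigO_atTop (hl : ∀ j, 0 < l j) :
    expSum c l =O[atTop] fun t : ℝ => Real.exp (-c * t) := by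
  unfold expSum
  have h : (fun t : ℝ => ∏ j, (1 - Real.exp (-l j * t))⁻¹) =O[atTop] fun _ => (1 : ℝ) := by
    have hlim : Tendsto (fun t : ℝ => ∏ j, (1 - Real.exp (-l j * t))⁻¹) atTop
        (𝓝 (∏ _j : Fin m, (1 - 0 : ℝ)⁻¹)) := by
      refine tendsto_finsetProd _ fun j _ => ?_
      refine Tendsto.inv₀ (tendsto_const_nhds.sub ?_) (by norm_num)
      refine Real.tendsto_exp_atBot.comp ?_
      exact tendsto_id.const_mul_atTop_of_neg (by have := hl j; linarith)
    exact hlim.isBigO_one ℝ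
  simpa using (isBigO_refl (fun t : ℝ => Real.exp (-c * t)) atTop).mul h

lemma polar_isBigO_atTop (a : ℝ) {b : ℝ} (hb : b < 1) :
    (fun t : ℝ => t ^ a * Real.exp (-t)) =O[atTop] fun t : ℝ => Real.exp (-b * t) := by
  have h := (isLittleO_rpow_exp_pos_mul_atTop a (b := 1 - b) (by linarith)).isBigO.mul
    (isBigO_refl (fun t : ℝ => Real.exp (-t)) atTop)
  refine h.congr_right fun t => ?_
  rw [← Real.exp_add]
  congr 1
  ring

lemma expSumRem_isBigO_atTop (hl : ∀ j, 0 < l j) {b : ℝ} (hb : b < 1) (hbc : b ≤ c) :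
    expSumRem c l =O[atTop] fun t : ℝ => Real.exp (-b * t) := by
  unfold expSumRem
  refine IsBigO.sub ((expSum_isBigO_atTop hl).trans ?_)
    (IsBigO.fun_sum fun i _ => (polar_isBigO_atTop _ hb).const_mul_left _)
  refine IsBigO.of_bound 1 ?_
  filter_upwards [eventually_ge_atTop 0] with t ht
  rw [Real.norm_of_nonneg (Real.exp_pos _).le, Real.norm_of_nonneg (Real.exp_pos _).le, one_mul]
  exact Real.exp_le_exp.2 (by nlinarith)

lemma hasMellin_polar {a : ℝ} {z : ℂ} (hz : -a < z.re) :
    HasMellin (fun t : ℝ => ((t ^ a * Real.exp (-t) : ℝ) : ℂ)) z (Complex.Gamma (z + a)) := by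
  have hre : 0 < (z + a).re := by simp; linarith
  have hG : HasMellin (fun t : ℝ => ((Real.exp (-t) : ℝ) : ℂ)) (z + a) (Complex.Gamma (z + a)) := by
    refine ⟨?_, by rw [Complex.Gamma_eq_integral hre, Complex.GammaIntegral_eq_mellin]⟩
    refine (Complex.GammaIntegral_convergent hre).congr_fun (fun t _ => ?_) measurableSet_Ioi
    simp [mul_comm]
  have hG' : HasMellin (fun t : ℝ => (t : ℂ) ^ (a : ℂ) • ((Real.exp (-t) : ℝ) : ℂ)) z
      (Complex.Gamma (z + a)) :=
    ⟨MellinConvergent.cpow_smul.2 hG.1, by rw [mellin_cpow_smul, hG.2]⟩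
  have heq : Set.EqOn (fun t : ℝ => (t : ℂ) ^ (a : ℂ) • ((Real.exp (-t) : ℝ) : ℂ))
      (fun t : ℝ => ((t ^ a * Real.exp (-t) : ℝ) : ℂ)) (Set.Ioi 0) := fun t ht => by
    simp only [smul_eq_mul, Complex.ofReal_mul, Complex.ofReal_cpow (le_of_lt (Set.mem_Ioi.1 ht))]
  constructor
  · refine hG'.1.congr_fun (fun t ht => ?_) measurableSet_Ioi
    simp only [heq ht]
  · rw [← hG'.2]
    refine setIntegral_congr_fun measurableSet_Ioi fun t ht => ?_
    simp only [heq ht]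

lemma Gamma_add_natCast {w : ℂ} (hw : 0 < w.re) (i : ℕ) :
    Complex.Gamma (w + i) = (∏ r ∈ Finset.range i, (w + r)) * Complex.Gamma w := by
  induction i with
  | zero => simp
  | succ i ih =>
    have hne : w + i ≠ 0 := fun h => by
      have := congrArg Complex.re h
      simp at this
      have h2 : (0 : ℝ) ≤ i := by positivity
      linarith
    rw [Nat.cast_succ, ← add_assoc, Complex.Gamma_add_one _ hne, ih, Finset.prod_range_succ]
    ring

lemma hasDerivAt_one_div_Gamma_zero : HasDerivAt (fun z => (Complex.Gamma z)⁻¹) 1 0 := by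
  have h1 : (fun z => (Complex.Gamma z)⁻¹) = fun z => z * (Complex.Gamma (z + 1))⁻¹ :=
    funext Complex.one_div_Gamma_eq_self_mul_one_div_Gamma_add_one
  rw [h1]
  have h2 : DifferentiableAt ℂ (fun z => (Complex.Gamma (z + 1))⁻¹) 0 :=
    (Complex.differentiable_one_div_Gamma.comp (differentiable_id.add_const 1)) 0
  simpa using (hasDerivAt_id' (0 : ℂ)).fun_mul h2.hasDerivAt

lemma sum_polarCoeff (c : ℝ) (l : Fin m → ℝ) :
    ∑ i ∈ Finset.range (m + 1), polarCoeff c l i * ((-1) ^ (m - i) / ((m - i).factorial : ℝ)) =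
      PowerSeries.coeff m (todd (-c) fun j => -l j) := by
  have h : todd (-c) (fun j => -l j) =
      (PowerSeries.rescale 1 (PowerSeries.exp ℝ) * todd (-c) fun j => -l j) *
        PowerSeries.rescale (-1) (PowerSeries.exp ℝ) := by
    have : PowerSeries.rescale (-1 : ℝ) (PowerSeries.exp ℝ) *
        PowerSeries.rescale (1 : ℝ) (PowerSeries.exp ℝ) = 1 := by
      rw [PowerSeries.exp_mul_exp_eq_exp_add]
      simp
    calc _ = (PowerSeries.rescale (-1 : ℝ) (PowerSeries.exp ℝ) *
        PowerSeries.rescale (1 : ℝ) (PowerSeries.exp ℝ)) * todd (-c) (fun j => -l j) := by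
          rw [this, one_mul]
      _ = _ := by ring
  conv_rhs => rw [h, PowerSeries.coeff_mul,
    Finset.Nat.sum_antidiagonal_eq_sum_range_succ_mk]
  refine Finset.sum_congr rfl fun i _ => ?_
  simp [polarCoeff, PowerSeries.coeff_exp, div_eq_mul_inv]

lemma prod_range_sub (m i : ℕ) (hi : i ≤ m) :
    ∏ r ∈ Finset.range i, ((r : ℂ) - m) =
      (-1) ^ m * m.factorial * ((-1) ^ (m - i) / ((m - i).factorial : ℂ)) := by
  induction i with
  | zero =>
    have : (m.factorial : ℂ) ≠ 0 := by exact_mod_cast m.factorial_ne_zero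
    have h2 : ((-1 : ℂ) ^ m) * (-1) ^ m = 1 := by rw [← mul_pow]; simp
    simp
    field_simp
    rw [pow_two, h2]
  | succ i ih =>
    obtain ⟨k, rfl⟩ := Nat.exists_eq_add_of_le hi
    rw [Finset.prod_range_succ, ih (by omega)]
    rw [show i + 1 + k - i = k + 1 by omega, show i + 1 + k - (i + 1) = k by omega,
      Nat.factorial_succ k]
    have h1 : (k.factorial : ℂ) ≠ 0 := by exact_mod_cast k.factorial_ne_zero
    have h2 : (k + 1 : ℂ) ≠ 0 := by exact_mod_cast k.succ_ne_zero
    push_cast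
    field_simp
    ring

/-- The Barnes zeta function `∑ x, ℓ(x) ^ (-z)` divided by `Γ(z - m)` is holomorphic for
`Re z > -1`; at `z = 0` it vanishes, with derivative `(-1)^m m!` times the constant term of
`expSum`. -/
theorem exists_barnes_continuation (hc : 0 < c) (hl : ∀ j, 0 < l j) :
    ∃ V : ℂ → ℂ, DifferentiableOn ℂ V {z | -1 < z.re} ∧ V 0 = 0 ∧
      HasDerivAt V ((-1) ^ m * m.factorial *
        ((PowerSeries.coeff m (todd (-c) fun j => -l j) : ℝ) : ℂ)) 0 ∧
      ∀ z : ℂ, (m : ℝ) < z.re → HasSum (fun x : Fin m → ℕ =>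
        (Complex.Gamma (z - m))⁻¹ * (affineForm c l x : ℂ) ^ (-z)) (V z) := by
  set G : ℝ → ℂ := fun t => (expSumRem c l t : ℂ) with hG
  -- `expSum` decays like `e^(-c t)` and the subtracted terms decay like `e^(-t)` times a power of `t`.
  have hb : 0 < min c (1 / 2) := by positivity
  have hloc : LocallyIntegrableOn G (Set.Ioi 0) volume :=
    (Complex.continuous_ofReal.comp_continuousOn (continuousOn_expSumRem hl)).locallyIntegrableOn
      measurableSet_Ioi
  have htop : G =O[atTop] fun t => Real.exp (-(min c (1 / 2)) * t) :=
    (Complex.isBigO_ofReal_left (f := expSumRem c l)).2 (expSumRem_isBigO_atTop hl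
      (lt_of_le_of_lt (min_le_right _ _) (by norm_num)) (min_le_left _ _))
  have hzero : G =O[𝓝[>] 0] fun t : ℝ => t ^ (-(-1) : ℝ) :=
    (Complex.isBigO_ofReal_left (f := expSumRem c l)).2 (expSumRem_isBigO_zero hl)
  have hconv : ∀ z : ℂ, -1 < z.re → MellinConvergent G z := fun z hz =>
    mellinConvergent_of_isBigO_rpow_exp hb hloc htop hzero hz
  have hdiff : ∀ z : ℂ, -1 < z.re → DifferentiableAt ℂ (mellin G) z := fun z hz =>
    mellin_differentiableAt_of_isBigO_rpow_exp hb hloc htop hzero hz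
  set U : ℂ → ℂ := fun z => mellin G z * (Complex.Gamma (z - m))⁻¹ +
    ∑ i ∈ Finset.range (m + 1), (polarCoeff c l i : ℂ) * ∏ r ∈ Finset.range i, (z - m + r) with hU
  have hUdiff : ∀ z : ℂ, -1 < z.re → DifferentiableAt ℂ U z := fun z hz => by
    refine ((hdiff z hz).mul ?_).add (DifferentiableAt.fun_sum fun i _ => ?_)
    · exact (Complex.differentiable_one_div_Gamma.comp (differentiable_id.sub_const _)) z
    · refine DifferentiableAt.const_mul ?_ _
      exact (HasDerivAt.fun_finsetProd (u := Finset.range i) fun (r : ℕ) _ =>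
        ((hasDerivAt_id' z).sub_const (m : ℂ)).add_const (r : ℂ)).differentiableAt
  have hU0 : U 0 = (-1) ^ m * m.factorial *
        ((PowerSeries.coeff m (todd (-c) fun j => -l j) : ℝ) : ℂ) := by
    rw [← sum_polarCoeff, hU]
    simp only [zero_sub, Complex.Gamma_neg_nat_eq_zero, inv_zero, mul_zero, zero_add]
    rw [Complex.ofReal_sum, Finset.mul_sum]
    refine Finset.sum_congr rfl fun i hi => ?_
    simp only [neg_add_eq_sub]
    rw [prod_range_sub m i (Nat.lt_succ_iff.1 (Finset.mem_range.1 hi))]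
    push_cast
    ring
  refine ⟨fun z => (Complex.Gamma z)⁻¹ * U z, fun z hz => ?_, by simp, ?_, fun z hz => ?_⟩
  · exact ((Complex.differentiable_one_div_Gamma z).mul
      (hUdiff z hz)).differentiableWithinAt
  · have := hasDerivAt_one_div_Gamma_zero.fun_mul (hUdiff 0 (by simp)).hasDerivAt
    rw [← hU0]
    simpa using this
  · have hz0 : 0 < z.re := lt_of_le_of_lt (by positivity) hz
    have hw : 0 < (z - m).re := by simpa using hz
    have hsummable : Summable fun x : Fin m → ℕ => ‖(1 : ℂ)‖ / affineForm c l x ^ z.re := by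
      have h1 := (summable_powProd_mul (ι := Unit) (κ := Fin m) (c := fun _ => c) (l := fun _ => l)
        (fun _ => hc) (fun _ => hl) (d := 0) one_mem_boundedSym (s := fun _ => z)
        (by simpa using hz)).norm
      refine h1.congr fun x => ?_
      have hpos := affineForm_pos hc hl x
      simp [powProd, Complex.norm_cpow_eq_rpow_re_of_pos hpos, Real.rpow_neg hpos.le]
    have hsum := hasSum_mellin (a := fun _ : Fin m → ℕ => (1 : ℂ)) (p := fun x => affineForm c l x)
      (F := fun t => (expSum c l t : ℂ)) (s := z) (fun x => Or.inr (affineForm_pos hc hl x)) hz0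
      (fun t ht => by
        simpa using Complex.hasSum_ofReal.2 (hasSum_exp_affineForm (c := c) hl ht)) hsummable
    have hpolar : ∀ N : ℕ, HasMellin (fun t : ℝ => ∑ i ∈ Finset.range N,
        (polarCoeff c l i : ℂ) * ((t ^ ((i : ℝ) - m) * Real.exp (-t) : ℝ) : ℂ)) z
        (∑ i ∈ Finset.range N, (polarCoeff c l i : ℂ) * Complex.Gamma (z + ((i : ℝ) - m : ℝ))) := by
      intro N
      induction N with
      | zero => exact ⟨by simp [MellinConvergent], by simp [mellin]⟩
      | succ N ih =>
        have hp := hasMellin_polar (a := (N : ℝ) - m) (z := z) (by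
          have : (0 : ℝ) ≤ N := by positivity
          linarith)
        have hp' : HasMellin (fun t : ℝ => (polarCoeff c l N : ℂ) *
            ((t ^ ((N : ℝ) - m) * Real.exp (-t) : ℝ) : ℂ)) z
            ((polarCoeff c l N : ℂ) * Complex.Gamma (z + ((N : ℝ) - m : ℝ))) := by
          refine ⟨hp.1.const_smul (polarCoeff c l N : ℂ), ?_⟩
          rw [← hp.2]
          exact mellin_const_smul _ _ (polarCoeff c l N : ℂ)
        have h3 := hasMellin_add ih.1 hp'.1
        simp only [Finset.sum_range_succ]
        rw [← ih.2, ← hp'.2]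
        exact h3
    have hmellin : mellin (fun t => (expSum c l t : ℂ)) z = mellin G z +
        ∑ i ∈ Finset.range (m + 1), (polarCoeff c l i : ℂ) *
          Complex.Gamma (z + ((i : ℝ) - m : ℝ)) := by
      rw [← (hpolar (m + 1)).2, ← (hasMellin_add (hconv z (by linarith)) (hpolar (m + 1)).1).2]
      congr 1
      funext t
      simp only [hG, expSumRem]
      push_cast
      ring
    have hGz := Complex.Gamma_ne_zero_of_re_pos hz0
    have hGw := Complex.Gamma_ne_zero_of_re_pos hw
    have hval : mellin (fun t => (expSum c l t : ℂ)) z = U z * Complex.Gamma (z - m) := by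
      rw [hmellin, hU, add_mul, inv_mul_cancel_right₀ hGw, Finset.sum_mul]
      congr 1
      refine Finset.sum_congr rfl fun i _ => ?_
      rw [mul_assoc, ← Gamma_add_natCast hw]
      congr 2
      push_cast
      ring
    rw [hval] at hsum
    have h5 := hsum.mul_left ((Complex.Gamma z)⁻¹ * (Complex.Gamma (z - m))⁻¹)
    convert! h5 using 1
    · funext x
      rw [Complex.cpow_neg]
      field_simp
    · field_simp

end Barnes

/-! ### Holomorphic functions on half-planes and the zeros of `1 / Γ` -/

section HalfPlane

open Filter Topology

lemma isOpen_re_gt (B : ℝ) : IsOpen {z : ℂ | B < z.re} :=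
  isOpen_lt continuous_const Complex.continuous_re

/-- Functions that are holomorphic on a half-plane and agree far to the right agree. -/
lemma eqOn_of_eq_of_re_gt {f g : ℂ → ℂ} {B b : ℝ} (hf : DifferentiableOn ℂ f {z | B < z.re})
    (hg : DifferentiableOn ℂ g {z | B < z.re}) (h : ∀ z : ℂ, b < z.re → f z = g z) :
    Set.EqOn f g {z | B < z.re} := by
  set z₀ : ℂ := ((max B b + 1 : ℝ) : ℂ) with hz₀
  have hz : max B b < z₀.re := by simp [hz₀]
  refine AnalyticOnNhd.eqOn_of_preconnected_of_eventuallyEq (z₀ := z₀)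
    (hf.analyticOnNhd (isOpen_re_gt B)) (hg.analyticOnNhd (isOpen_re_gt B))
    (convex_halfSpace_re_gt B).isPreconnected ((le_max_left B b).trans_lt hz) ?_
  filter_upwards [(isOpen_re_gt b).mem_nhds ((le_max_right B b).trans_lt hz)] with z hz
  exact h z hz

/-- Holomorphic functions on larger and larger half-planes that agree far to the right come from an
entire function. -/
lemma exists_entire_of_forall_halfPlane {w : ℕ → ℂ → ℂ}
    (hw : ∀ K : ℕ, DifferentiableOn ℂ (w K) {z | -(K : ℝ) < z.re})
    (h : ∀ K : ℕ, ∃ b : ℝ, ∀ z : ℂ, b < z.re → w K z = w 0 z) :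
    ∃ f : ℂ → ℂ, Differentiable ℂ f ∧ ∀ K : ℕ, Set.EqOn f (w K) {z | -(K : ℝ) < z.re} := by
  have hKK : ∀ K K' : ℕ, K ≤ K' → Set.EqOn (w K') (w K) {z | -(K : ℝ) < z.re} := by
    intro K K' hle
    obtain ⟨b, hb⟩ := h K
    obtain ⟨b', hb'⟩ := h K'
    have hle' : (K : ℝ) ≤ K' := by exact_mod_cast hle
    refine eqOn_of_eq_of_re_gt (b := max b b')
      ((hw K').mono fun z hz => lt_of_le_of_lt (neg_le_neg hle') hz) (hw K) fun z hz => ?_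
    rw [hb z ((le_max_left _ _).trans_lt hz), hb' z ((le_max_right _ _).trans_lt hz)]
  choose N hN using fun z : ℂ => exists_nat_gt (-z.re)
  have heq : ∀ K : ℕ, Set.EqOn (fun z => w (N z) z) (w K) {z | -(K : ℝ) < z.re} := by
    intro K z hz
    rcases le_total (N z) K with hle | hle
    · exact (hKK _ _ hle (show -(N z : ℝ) < z.re by linarith [hN z])).symm
    · exact hKK _ _ hle hz
  refine ⟨fun z => w (N z) z, fun z => ?_, heq⟩
  have hmem : {y : ℂ | -(N z : ℝ) < y.re} ∈ 𝓝 z :=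
    (isOpen_re_gt _).mem_nhds (show -(N z : ℝ) < z.re by linarith [hN z])
  exact ((hw (N z)).differentiableAt hmem).congr_of_eventuallyEq
    (eventually_of_mem hmem fun y hy => heq (N z) hy)

lemma one_div_Gamma_eq_prod (w : ℂ) (m : ℕ) : (Complex.Gamma w)⁻¹ =
    (∏ r ∈ Finset.range m, (w + r)) * (Complex.Gamma (w + m))⁻¹ := by
  induction m with
  | zero => simp
  | succ m ih =>
    rw [ih, Complex.one_div_Gamma_eq_self_mul_one_div_Gamma_add_one, Finset.prod_range_succ]
    push_cast
    rw [add_assoc w]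
    ring

lemma hasDerivAt_one_div_Gamma_sub (m : ℕ) :
    HasDerivAt (fun z : ℂ => (Complex.Gamma (z - m))⁻¹) ((-1) ^ m * m.factorial) 0 := by
  have h1 : (fun z : ℂ => (Complex.Gamma (z - m))⁻¹) = fun z : ℂ =>
      (∏ r ∈ Finset.range m, (z - m + r)) * (Complex.Gamma z)⁻¹ := by
    funext z
    rw [one_div_Gamma_eq_prod (z - m) m, sub_add_cancel]
  rw [h1]
  have h2 := (HasDerivAt.fun_finsetProd (u := Finset.range m) fun (r : ℕ) _ =>
    ((hasDerivAt_id' (0 : ℂ)).sub_const (m : ℂ)).add_const (r : ℂ)).fun_mul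
    hasDerivAt_one_div_Gamma_zero
  refine h2.congr_deriv ?_
  simp only [Complex.Gamma_zero, inv_zero, mul_zero, zero_add, mul_one, zero_sub, neg_add_eq_sub]
  rw [prod_range_sub m m le_rfl]
  simp

end HalfPlane

/-! ### Restriction to the diagonal and the value at `0` -/

section Zeta

variable {ι : Type*} [Fintype ι] {m : ℕ} {c : ι → ℝ} {l : ι → Fin m → ℝ}

lemma powProd_single [DecidableEq ι] (i : ι) (z : ℂ) (x : Fin m → ℕ) :
    powProd c l (Pi.single i z) x = (affineForm (c i) (l i) x : ℂ) ^ (-z) := by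
  rw [powProd, Finset.prod_eq_single i]
  · simp
  · intro j _ hj
    simp [hj]
  · simp

/-- The function `W(s) = ∑ x, ∏ ℓ_i(x) ^ (-s_i) / Γ(∑ s_i - m)` vanishes at `s = 0`. Its derivative
there along the diagonal is the sum of its partial derivatives, which are known because on each
coordinate axis `W` is a Barnes zeta function divided by `Γ(z - m)`. -/
lemma hasDerivAt_diagonal (hc : ∀ i, 0 < c i) (hl : ∀ i j, 0 < l i j) {W : (ι → ℂ) → ℂ} {B b : ℝ}
    (hB : B ≤ -1) (hW : DifferentiableOn ℂ W {s | B < (∑ i, s i).re})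
    (hb : ∀ s : ι → ℂ, b < (∑ i, s i).re → HasSum (fun x =>
        (Complex.Gamma (∑ i, s i - Fintype.card (Fin m)))⁻¹ * powProd c l s x) (W s)) [Nonempty ι] :
    W 0 = 0 ∧ HasDerivAt (fun z : ℂ => W fun _ => z) (((-1) ^ m * m.factorial : ℂ) *
      ((∑ i, PowerSeries.coeff m (todd (-c i) fun j => -l i j) : ℝ) : ℂ)) 0 := by
  classical
  choose V hV hV0 hVd hVs using fun i => exists_barnes_continuation (hc i) (hl i)
  have haxis : ∀ i, Set.EqOn (fun z : ℂ => W (Pi.single i z)) (V i) {z | -1 < z.re} := by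
    intro i
    refine eqOn_of_eq_of_re_gt (b := max b m) ?_ (hV i) fun z hz => ?_
    · refine hW.comp (g := W) (f := fun z : ℂ => (Pi.single i z : ι → ℂ)) ?_ fun z hz => ?_
      · exact (ContinuousLinearMap.single ℂ (fun _ : ι => ℂ) i).differentiable.differentiableOn
      · have : -1 < z.re := hz
        rw [Set.mem_ofPred_eq, Finset.sum_pi_single', if_pos (Finset.mem_univ i)]
        linarith
    · have h1 := hb (Pi.single i z) (by
        rw [Finset.sum_pi_single', if_pos (Finset.mem_univ i)]
        exact (le_max_left _ _).trans_lt hz)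
      have h2 := hVs i z ((le_max_right _ _).trans_lt hz)
      simp only [powProd_single, Finset.sum_pi_single', Finset.mem_univ, if_true,
        Fintype.card_fin] at h1
      exact h1.unique h2
  obtain ⟨i₀⟩ := ‹Nonempty ι›
  have hW0 : W 0 = 0 := by
    have := haxis i₀ (show -1 < (0 : ℂ).re by simp)
    simpa [hV0] using this
  refine ⟨hW0, ?_⟩
  have hopen : IsOpen {s : ι → ℂ | B < (∑ i, s i).re} :=
    isOpen_lt continuous_const (by fun_prop)
  have hd : HasFDerivAt W (fderiv ℂ W 0) (0 : ι → ℂ) :=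
    (hW.differentiableAt (hopen.mem_nhds (by simp; linarith))).hasFDerivAt
  have hline : ∀ v : ι → ℂ, HasDerivAt (fun z : ℂ => W (z • v)) (fderiv ℂ W 0 v) 0 := by
    intro v
    have h1 : HasDerivAt (fun z : ℂ => z • v) v 0 := by
      simpa using (hasDerivAt_id (0 : ℂ)).smul_const v
    have h2 : HasFDerivAt W (fderiv ℂ W 0) ((0 : ℂ) • v) := by simpa using hd
    exact h2.comp_hasDerivAt 0 h1
  have hpart : ∀ i, fderiv ℂ W 0 (Pi.single i 1) = (-1) ^ m * m.factorial *
      ((PowerSeries.coeff m (todd (-c i) fun j => -l i j) : ℝ) : ℂ) := by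
    intro i
    refine (hline (Pi.single i 1)).unique ((hVd i).congr_of_eventuallyEq ?_)
    filter_upwards [(isOpen_re_gt (-1)).mem_nhds (show -1 < (0 : ℂ).re by simp)] with z hz
    rw [← haxis i hz, ← Pi.single_smul]
    simp
  have hone : (fun _ => 1 : ι → ℂ) = ∑ i, Pi.single i 1 :=
    (Finset.univ_sum_single (fun _ : ι => (1 : ℂ))).symm
  have h := hline fun _ => 1
  rw [hone, map_sum, Finset.sum_congr rfl fun i _ => hpart i, ← Finset.mul_sum,
    ← Complex.ofReal_sum, ← hone] at h
  convert! h using 1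
  funext z
  congr 1
  funext i
  simp

/-- The zeta function of a family of positive affine forms on `ℕ^m`, and its value at `0`. -/
theorem exists_zeta [Nonempty ι] (hc : ∀ i, 0 < c i) (hl : ∀ i j, 0 < l i j)
    (hm : m ≤ Fintype.card ι) :
    ∃ Z : ℂ → ℂ, Meromorphic Z ∧ AnalyticAt ℂ Z 0 ∧
      (∀ s : ℂ, 1 < s.re → HasSum (fun x => powProd c l (fun _ => s) x) (Z s)) ∧
      Z 0 = ((1 / (Fintype.card ι : ℝ) *
        ∑ i, PowerSeries.coeff m (todd (-c i) fun j => -l i j) : ℝ) : ℂ) := by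
  set n := Fintype.card ι with hn
  have hn0 : 0 < n := Fintype.card_pos
  have hn0' : (0 : ℝ) < n := by exact_mod_cast hn0
  have hsum : ∀ s : ℂ, ∑ _i : ι, s = n * s := fun s => by simp [hn]
  have hre : ∀ s : ℂ, (∑ _i : ι, s).re = n * s.re := fun s => by simp [hn]
  have hcard : ∀ s : ℂ, 1 < s.re → (m : ℝ) + (0 : ℤ) < n * s.re := fun s hs => by
    have : (m : ℝ) ≤ n := by exact_mod_cast hm
    push_cast
    nlinarith
  choose W hW b hb using fun K : ℕ => exists_continuation hc hl (-((K + 1 : ℝ) * n))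
  have hline : Differentiable ℂ fun (z : ℂ) (_ : ι) => z :=
    differentiable_pi.2 fun _ => differentiable_id
  have hWdiff : ∀ K : ℕ, DifferentiableOn ℂ (fun z : ℂ => W K fun _ => z) {z | -(K : ℝ) < z.re} := by
    intro K
    refine (hW K).comp (g := W K) (f := fun (z : ℂ) (_ : ι) => z) hline.differentiableOn
      fun z hz => ?_
    have hz' : -(K : ℝ) < z.re := hz
    change _ < (∑ _i : ι, z).re
    rw [hre]
    nlinarith
  have hWval : ∀ K : ℕ, ∀ z : ℂ, b K / n < z.re → HasSum (fun x =>
      (Complex.Gamma (n * z - m))⁻¹ * powProd c l (fun _ => z) x) (W K fun _ => z) := by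
    intro K z hz
    have := hb K (fun _ => z) (by rw [hre, mul_comm]; exact (div_lt_iff₀ hn0').1 hz)
    rwa [hsum, Fintype.card_fin] at this
  obtain ⟨f, hf, hfeq⟩ := exists_entire_of_forall_halfPlane hWdiff fun K =>
    ⟨max (b K / n) (b 0 / n), fun z hz => (hWval K z ((le_max_left _ _).trans_lt hz)).unique
      (hWval 0 z ((le_max_right _ _).trans_lt hz))⟩
  obtain ⟨hW0, hWd⟩ := hasDerivAt_diagonal hc hl (B := -((((1 : ℕ) : ℝ) + 1) * n)) (b := b 1) (by
    have : (1 : ℝ) ≤ n := by exact_mod_cast hn0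
    push_cast
    linarith) (hW 1) (hb 1)
  have hzero : (0 : ℂ) ∈ {z : ℂ | -((1 : ℕ) : ℝ) < z.re} := by simp
  have hf0 : f 0 = 0 := (hfeq 1 hzero).trans hW0
  have hfd := hWd.congr_of_eventuallyEq
    (Filter.eventually_of_mem ((isOpen_re_gt _).mem_nhds hzero) (hfeq 1))
  set g : ℂ → ℂ := fun z => (Complex.Gamma (n * z - m))⁻¹ with hg
  have hgdiff : Differentiable ℂ g :=
    Complex.differentiable_one_div_Gamma.comp (by fun_prop)
  have hg0 : g 0 = 0 := by simp [hg, Complex.Gamma_neg_nat_eq_zero]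
  have hgd : HasDerivAt g ((-1) ^ m * m.factorial * n) 0 := by
    have h1 : HasDerivAt (fun z : ℂ => (n : ℂ) * z) n 0 := by
      simpa using (hasDerivAt_id (0 : ℂ)).const_mul (n : ℂ)
    have h2 := hasDerivAt_one_div_Gamma_sub m
    rw [← mul_zero (n : ℂ)] at h2
    exact h2.comp 0 h1
  have hfs : Set.EqOn f (fun s => g s * ∑' x, powProd c l (fun _ => s) x) {s | 1 < s.re} := by
    refine eqOn_of_eq_of_re_gt (b := max 0 (b 0 / n)) hf.differentiableOn ?_ fun s hs => ?_
    · refine hgdiff.differentiableOn.mul ?_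
      have h1 := (differentiableOn_tsum_powProd_mul (κ := Fin m) hc hl one_mem_boundedSym).comp
        hline.differentiableOn (s := {s : ℂ | 1 < s.re}) fun s hs => by
          change _ < (∑ _i : ι, s).re
          rw [hre, Fintype.card_fin]
          exact hcard s hs
      simpa [Function.comp_def] using h1
    · have h0 : s ∈ {z : ℂ | -((0 : ℕ) : ℝ) < z.re} := by
        simpa using (le_max_left _ _).trans_lt hs
      rw [show f s = W 0 fun _ => s from hfeq 0 h0,
        ← (hWval 0 s ((le_max_right _ _).trans_lt hs)).tsum_eq, tsum_mul_left]
  have hslope : ∀ {h : ℂ → ℂ}, Differentiable ℂ h → Differentiable ℂ (dslope h 0) := fun hh =>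
    differentiableOn_univ.1 ((Complex.differentiableOn_dslope Filter.univ_mem).2
      hh.differentiableOn)
  have hfan := fun s => (hslope hf).analyticAt s
  have hgan := fun s => (hslope hgdiff).analyticAt s
  have hκ : ((-1) ^ m * m.factorial * n : ℂ) ≠ 0 := by
    have h1 : (m.factorial : ℂ) ≠ 0 := by exact_mod_cast m.factorial_ne_zero
    have h2 : (n : ℂ) ≠ 0 := by exact_mod_cast hn0.ne'
    exact mul_ne_zero (mul_ne_zero (pow_ne_zero _ (by norm_num)) h1) h2
  -- Both `f` and `g` vanish at `0`, so dividing each of them by `s` first makes the quotient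
  -- analytic there.
  refine ⟨fun s => dslope f 0 s / dslope g 0 s, fun s => (hfan s).meromorphicAt.div
    (hgan s).meromorphicAt, (hfan 0).div (hgan 0) (by rwa [dslope_same, hgd.deriv]),
    fun s hs => ?_, ?_⟩
  · have hs0 : s ≠ 0 := by
      rintro rfl
      simp at hs
      linarith
    have hgs : g s ≠ 0 := by
      refine inv_ne_zero (Complex.Gamma_ne_zero_of_re_pos ?_)
      have := hcard s hs
      simp at this ⊢
      exact this
    have h1 : dslope f 0 s / dslope g 0 s = ∑' x, powProd c l (fun _ => s) x := by
      rw [dslope_of_ne _ hs0, dslope_of_ne _ hs0, slope_def_field, slope_def_field, hf0, hg0,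
        hfs hs]
      simp only [sub_zero]
      field_simp
    change HasSum _ (dslope f 0 s / dslope g 0 s)
    rw [h1]
    refine Summable.hasSum ?_
    have := summable_powProd_mul hc hl (κ := Fin m) one_mem_boundedSym (s := fun _ => s)
      (by rw [hre, Fintype.card_fin]; exact hcard s hs)
    simpa using this
  · simp only [dslope_same, hfd.deriv, hgd.deriv]
    rw [mul_div_mul_left _ _ (left_ne_zero_of_mul hκ)]
    push_cast
    ring

end Zeta

/-! ### `h_0` and the multiple Bernoulli polynomials as coefficients of power series -/

section FormalSeries

variable {K : Type*} [Field K] [CharZero K]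

lemma one_sub_expSeries (c : K) :
    1 - expSeries c = HahnSeries.single 1 1 * HahnSeries.ofPowerSeries ℤ K (expQuot c) := by
  rw [expSeries, ← map_one (HahnSeries.ofPowerSeries ℤ K), ← map_sub, ← X_mul_expQuot, map_mul,
    HahnSeries.ofPowerSeries_X]

lemma todd_add {m : ℕ} (w y : K) (x : Fin m → K) :
    todd (w + y) x = PowerSeries.rescale w (PowerSeries.exp K) * todd y x := by
  rw [todd, todd, ← mul_assoc, PowerSeries.exp_mul_exp_eq_exp_add]

lemma expSeries_mul_div_eq {m : ℕ} (w y : K) {x : Fin m → K} (hx : ∀ j, x j ≠ 0) :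
    expSeries w * (expSeries y / ∏ j, (1 - expSeries (x j))) =
      HahnSeries.single (-m : ℤ) 1 * HahnSeries.ofPowerSeries ℤ K (todd (w + y) x) := by
  have hu : ∀ j, HahnSeries.ofPowerSeries ℤ K (expQuot (x j))⁻¹ =
      (HahnSeries.ofPowerSeries ℤ K (expQuot (x j)))⁻¹ := fun j => by
    refine eq_inv_of_mul_eq_one_left ?_
    rw [← map_mul, PowerSeries.inv_mul_cancel _ (by simpa [constantCoeff_expQuot] using hx j),
      map_one]
  have hs : (HahnSeries.single (1 : ℤ) (1 : K)) ^ m * HahnSeries.single (-m : ℤ) 1 = 1 := by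
    rw [HahnSeries.single_pow, HahnSeries.single_mul_single]
    simp
  have hprod : (∏ j, (1 - expSeries (x j)))⁻¹ = HahnSeries.single (-m : ℤ) 1 *
      HahnSeries.ofPowerSeries ℤ K (∏ j, (expQuot (x j))⁻¹) := by
    simp only [one_sub_expSeries, Finset.prod_mul_distrib, Finset.prod_const, Finset.card_univ,
      Fintype.card_fin, map_prod, hu, mul_inv, Finset.prod_inv_distrib]
    rw [inv_eq_of_mul_eq_one_right hs]
  rw [div_eq_mul_inv, hprod, todd_add, todd, map_mul, map_mul]
  simp only [expSeries]
  ring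

variable {F : Type*} [Field F] [CharZero F] {L : Submodule ℤ F}

/-- `h_0` in terms of power series. -/
lemma hZero_eq_sum {m : ℕ} {α : Fin m → F} {v : F ⧸ L} (hfin : (parallelotope α ∩ coset v).Finite)
    (w : K) {x : F →ₗ[ℚ] K} (hx : ∀ j, x (α j) ≠ 0) :
    hZero α v w x = ∑ δ ∈ hfin.toFinset,
      PowerSeries.coeff m (todd (w + x δ) fun j => x (α j)) := by
  rw [hZero, solomonHu, finsum_mem_eq_finite_toFinset_sum _ hfin, Finset.sum_div, Finset.mul_sum,
    HahnSeries.coeff_sum]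
  refine Finset.sum_congr rfl fun δ _ => ?_
  rw [expSeries_mul_div_eq w (x δ) hx]
  have h := HahnSeries.coeff_single_mul_add (r := (1 : K))
    (x := HahnSeries.ofPowerSeries ℤ K (todd (w + x δ) fun j => x (α j))) (a := (m : ℤ)) (b := -m)
  rw [add_neg_cancel, one_mul] at h
  rw [h, HahnSeries.ofPowerSeries_apply_coeff]

lemma map_todd {K' : Type*} [Field K'] [CharZero K'] (φ : K →+* K') {m : ℕ} (y : K)
    {x : Fin m → K} (hx : ∀ j, x j ≠ 0) :
    PowerSeries.map φ (todd y x) = todd (φ y) fun j => φ (x j) := by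
  have hexp : ∀ c : K, PowerSeries.map φ (PowerSeries.rescale c (PowerSeries.exp K)) =
      PowerSeries.rescale (φ c) (PowerSeries.exp K') := fun c => by
    ext k
    simp [PowerSeries.coeff_exp]
  have hquot : ∀ c : K, PowerSeries.map φ (expQuot c) = expQuot (φ c) := fun c => by
    ext k
    simp [expQuot]
  have hinv : ∀ j, PowerSeries.map φ (expQuot (x j))⁻¹ = (expQuot (φ (x j)))⁻¹ := fun j => by
    rw [PowerSeries.eq_inv_iff_mul_eq_one (by simpa [constantCoeff_expQuot] using hx j), ← hquot,
      ← map_mul, PowerSeries.inv_mul_cancel _ (by simpa [constantCoeff_expQuot] using hx j),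
      map_one]
  simp only [todd, map_mul, map_prod, hexp, hinv]

/-- `h_0` is natural in the field of values. -/
lemma map_hZero {K' : Type*} [Field K'] [CharZero K'] (φ : K →+* K') {m : ℕ} {α : Fin m → F}
    {v : F ⧸ L} (hfin : (parallelotope α ∩ coset v).Finite) (w : K) {x : F →ₗ[ℚ] K}
    {x' : F →ₗ[ℚ] K'} (hx : ∀ j, x (α j) ≠ 0) (h : ∀ y, φ (x y) = x' y) :
    φ (hZero α v w x) = hZero α v (φ w) x' := by
  have hx' : ∀ j, x' (α j) ≠ 0 := fun j => by
    rw [← h]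
    exact (map_ne_zero φ).2 (hx j)
  rw [hZero_eq_sum hfin w hx, hZero_eq_sum hfin (φ w) hx', map_sum]
  refine Finset.sum_congr rfl fun δ _ => ?_
  rw [← PowerSeries.coeff_map, map_todd φ _ hx, map_add, h]
  simp only [h]

lemma rescale_bernoulliPowerSeries {c : K} (hc : c ≠ 0) :
    PowerSeries.rescale c (bernoulliPowerSeries K) = PowerSeries.C (-c) * (expQuot c)⁻¹ := by
  rw [PowerSeries.eq_mul_inv_iff_mul_eq (by simpa [constantCoeff_expQuot] using hc)]
  have h := congrArg (PowerSeries.rescale c) (bernoulliPowerSeries_mul_exp_sub_one K)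
  rw [map_mul, map_sub, map_one, PowerSeries.rescale_X] at h
  refine mul_left_cancel₀ PowerSeries.X_ne_zero ?_
  have h2 := X_mul_expQuot c
  calc _ = PowerSeries.rescale c (bernoulliPowerSeries K) * (PowerSeries.X * expQuot c) := by ring
    _ = -(PowerSeries.rescale c (bernoulliPowerSeries K) *
        (PowerSeries.rescale c (PowerSeries.exp K) - 1)) := by rw [h2]; ring
    _ = _ := by rw [h, map_neg]; ring

lemma multipleBernoulli_eq {n : ℕ} (k : ℕ) (z : K) {ω : Fin n → K} (hω : ∀ j, ω j ≠ 0) :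
    multipleBernoulli k z ω = k.factorial * ((-1) ^ n * ∏ j, ω j) *
      PowerSeries.coeff k (todd z ω) := by
  have h : PowerSeries.rescale z (PowerSeries.exp K) *
      ∏ j, PowerSeries.rescale (ω j) (bernoulliPowerSeries K) =
      PowerSeries.C ((-1) ^ n * ∏ j, ω j) * todd z ω := by
    have h1 : ∀ j, PowerSeries.rescale (ω j) (bernoulliPowerSeries K) =
      PowerSeries.C (-(ω j)) * (expQuot (ω j))⁻¹ := fun j => rescale_bernoulliPowerSeries (hω j)
    simp only [h1, Finset.prod_mul_distrib, todd, ← map_prod, Finset.prod_neg, Finset.card_univ,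
      Fintype.card_fin]
    ring
  rw [multipleBernoulli, h, PowerSeries.coeff_C_mul]
  ring

end FormalSeries

/-! ### Decomposition of a simplicial cone into translates of lattice points -/

section Cone

variable {F : Type*} [Field F] [CharZero F] {L : Submodule ℤ F} {m : ℕ} {α : Fin m → F} {v : F ⧸ L}

lemma mem_coset_iff_sub_mem {F : Type*} [Field F] {L : Submodule ℤ F} {v : F ⧸ L} {x y : F}
    (hy : y ∈ coset v) : x ∈ coset v ↔ x - y ∈ L := by
  have hy' : (Submodule.Quotient.mk y : F ⧸ L) = v := hy
  rw [← Submodule.Quotient.eq, hy']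
  rfl

/-- Linear forms on `F` that extend the coordinates with respect to the family `α`. -/
lemma exists_coord (hind : LinearIndependent ℚ α) :
    ∃ g : F →ₗ[ℚ] (Fin m → ℚ), ∀ c : Fin m → ℚ, g (∑ j, c j • α j) = c := by
  obtain ⟨g, hg⟩ := (Fintype.linearCombination ℚ α).exists_leftInverse_of_injective
    (LinearMap.ker_eq_bot.2 (hind.fintypeLinearCombination_injective))
  refine ⟨g, fun c => ?_⟩
  simpa [Fintype.linearCombination_apply] using LinearMap.congr_fun hg c

/-- A linear form has bounded denominators on a finitely generated group. -/
lemma exists_common_den (hL : L.FG) (f : F →ₗ[ℚ] ℚ) :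
    ∃ D : ℕ, 0 < D ∧ ∀ x ∈ L, ∃ z : ℤ, f x = z / D := by
  obtain ⟨S, rfl⟩ := hL
  refine ⟨∏ s ∈ S, (f s).den, Finset.prod_pos fun s _ => (f s).den_pos, fun x hx => ?_⟩
  have hD : ((∏ s ∈ S, (f s).den : ℕ) : ℚ) ≠ 0 := by
    exact_mod_cast (Finset.prod_pos fun s _ => (f s).den_pos).ne'
  induction hx using Submodule.span_induction with
  | mem s hs =>
    obtain ⟨k, hk⟩ := Finset.dvd_prod_of_mem (fun s => (f s).den) hs
    refine ⟨(f s).num * k, ?_⟩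
    have hk0 : (k : ℚ) ≠ 0 := by
      rintro h
      have : k = 0 := by exact_mod_cast h
      rw [hk, this] at hD
      simp at hD
    rw [hk]
    push_cast
    rw [mul_div_mul_right _ _ hk0, Rat.num_div_den]
  | zero => exact ⟨0, by simp⟩
  | add x y _ _ hx hy =>
    obtain ⟨a, ha⟩ := hx
    obtain ⟨b, hb⟩ := hy
    exact ⟨a + b, by rw [map_add, ha, hb]; push_cast; ring⟩
  | smul n x _ hx =>
    obtain ⟨a, ha⟩ := hx
    exact ⟨n * a, by rw [map_zsmul, ha, zsmul_eq_mul]; push_cast; ring⟩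

lemma finite_parallelotope_inter_coset (hL : L.FG) (hind : LinearIndependent ℚ α) :
    (parallelotope α ∩ coset v).Finite := by
  obtain ⟨g, hg⟩ := exists_coord hind
  rcases (parallelotope α ∩ coset v).eq_empty_or_nonempty with h | ⟨δ₀, hδ₀, hv₀⟩
  · rw [h]; exact Set.finite_empty
  choose D hD0 hD using fun j => exists_common_den hL ((LinearMap.proj j).comp g)
  obtain ⟨c₀, hc₀, rfl⟩ := hδ₀
  refine Set.Finite.subset ((Fintype.piFinset fun j =>
    Finset.Icc (-(D j : ℤ)) (D j)).finite_toSet.image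
      fun z : Fin m → ℤ => ∑ j, (c₀ j + (z j : ℚ) / D j) • α j) ?_
  rintro _ ⟨⟨c, hc, rfl⟩, hv⟩
  choose z hz using fun j => hD j _ ((mem_coset_iff_sub_mem hv₀).1 hv)
  have hz' : ∀ j, c j - c₀ j = z j / D j := fun j => by
    have := hz j
    rwa [LinearMap.comp_apply, map_sub, hg, hg] at this
  refine ⟨z, ?_, ?_⟩
  · rw [Finset.mem_coe, Fintype.mem_piFinset]
    intro j
    have hDj : (0 : ℚ) < D j := by exact_mod_cast hD0 j
    have h1 := hz' j
    rw [eq_div_iff hDj.ne'] at h1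
    have h2 := hc j
    have h3 := hc₀ j
    rw [Finset.mem_Icc]
    constructor
    · have : (-(D j) : ℚ) ≤ z j := by rw [← h1]; nlinarith
      exact_mod_cast this
    · have : (z j : ℚ) ≤ D j := by rw [← h1]; nlinarith
      exact_mod_cast this
  · refine Finset.sum_congr rfl fun j _ => ?_
    congr 1
    rw [← hz' j]
    ring

/-- The translate of `δ` by a nonnegative integral combination of the generators. -/
def translate (α : Fin m → F) (δ : F) (x : Fin m → ℕ) : F := δ + ∑ j, (x j : ℚ) • α j

lemma translate_injective (hind : LinearIndependent ℚ α) (δ : F) :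
    Function.Injective (translate α δ) := by
  obtain ⟨g, hg⟩ := exists_coord hind
  intro x y hxy
  have h := congrArg g (add_left_cancel hxy)
  rw [hg, hg] at h
  funext j
  exact_mod_cast congrFun h j

lemma translate_eq_iff (hind : LinearIndependent ℚ α) {δ δ' : F} (hδ : δ ∈ parallelotope α)
    (hδ' : δ' ∈ parallelotope α) {x y : Fin m → ℕ} (h : translate α δ x = translate α δ' y) :
    δ = δ' := by
  obtain ⟨g, hg⟩ := exists_coord hind
  obtain ⟨c, hc, rfl⟩ := hδ
  obtain ⟨c', hc', rfl⟩ := hδ'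
  simp only [translate, ← Finset.sum_add_distrib, ← add_smul] at h
  have h1 := congrArg g h
  rw [hg fun j => c j + x j, hg fun j => c' j + y j] at h1
  refine Finset.sum_congr rfl fun j _ => ?_
  have h2 : c j + x j = c' j + y j := congrFun h1 j
  have h3 : Int.fract (c j + x j) = Int.fract (c' j + y j) := by rw [h2]
  rw [Int.fract_add_natCast, Int.fract_add_natCast, Int.fract_eq_self.2 (hc j),
    Int.fract_eq_self.2 (hc' j)] at h3
  rw [h3]

lemma sum_natCast_smul_mem (hα : ∀ j, α j ∈ L) (x : Fin m → ℕ) :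
    ∑ j, (x j : ℚ) • α j ∈ L := by
  refine Submodule.sum_mem _ fun j _ => ?_
  rw [Nat.cast_smul_eq_nsmul]
  exact nsmul_mem (hα j) _

/-- Every point of the cone in the coset is, in a unique way, a point of the parallelotope plus a
nonnegative integral combination of the generators. -/
lemma closedCone_inter_coset (hα : ∀ j, α j ∈ L) :
    closedCone α ∩ coset v = ⋃ δ ∈ parallelotope α ∩ coset v, Set.range (translate α δ) := by
  ext μ
  simp only [Set.mem_iUnion, Set.mem_range, exists_prop]
  constructor
  · rintro ⟨⟨c, hc, rfl⟩, hv⟩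
    have hsum : ∑ j, c j • α j = translate α (∑ j, Int.fract (c j) • α j) fun j => ⌊c j⌋₊ := by
      rw [translate, ← Finset.sum_add_distrib]
      refine Finset.sum_congr rfl fun j _ => ?_
      rw [← add_smul]
      congr 1
      rw [natCast_floor_eq_intCast_floor (hc j), Int.fract_add_floor]
    refine ⟨∑ j, Int.fract (c j) • α j,
      ⟨⟨fun j => Int.fract (c j), fun j => ⟨Int.fract_nonneg _, Int.fract_lt_one _⟩, rfl⟩, ?_⟩,
      fun j => ⌊c j⌋₊, hsum.symm⟩
    rw [mem_coset_iff_sub_mem hv, hsum, translate, sub_add_cancel_left]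
    exact neg_mem (sum_natCast_smul_mem hα _)
  · rintro ⟨δ, ⟨⟨c, hc, rfl⟩, hv⟩, x, rfl⟩
    refine ⟨⟨fun j => c j + x j, fun j => add_nonneg (hc j).1 (by positivity), ?_⟩, ?_⟩
    · simp only [translate, add_smul, Finset.sum_add_distrib]
    · rw [mem_coset_iff_sub_mem hv, translate, add_sub_cancel_left]
      exact sum_natCast_smul_mem hα _

lemma generator_mem_closedCone (j : Fin m) : α j ∈ closedCone α := by
  classical
  exact ⟨Pi.single j 1, fun k => by by_cases h : k = j <;> simp [h],
    by simp [Pi.single_apply]⟩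

lemma parallelotope_subset_closedCone : parallelotope α ⊆ closedCone α := by
  rintro _ ⟨c, hc, rfl⟩
  exact ⟨c, fun j => (hc j).1, rfl⟩

end Cone

/-! ### Norm and trace in a totally real field -/

section TotallyReal

variable {F : Type*} [Field F] [NumberField F] [NumberField.IsTotallyReal F]

/-- All complex embeddings of a totally real field are real. -/
noncomputable def realEmbeddingEquiv (F : Type*) [Field F] [NumberField F]
    [NumberField.IsTotallyReal F] : (F →+* ℝ) ≃ (F →ₐ[ℚ] ℂ) :=
  Equiv.ofBijective (fun σ => (Complex.ofRealHom.comp σ).toRatAlgHom) <| by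
    constructor
    · intro σ τ h
      ext x
      have := DFunLike.congr_fun h x
      exact Complex.ofReal_injective this
    · intro φ
      have hφ : NumberField.ComplexEmbedding.IsReal (φ : F →+* ℂ) := by
        have := NumberField.IsTotallyReal.isReal (NumberField.InfinitePlace.mk (φ : F →+* ℂ))
        rwa [NumberField.InfinitePlace.isReal_mk_iff] at this
      refine ⟨hφ.embedding, ?_⟩
      ext x
      exact NumberField.ComplexEmbedding.IsReal.coe_embedding_apply hφ x

lemma realEmbeddingEquiv_apply (σ : F →+* ℝ) (x : F) : realEmbeddingEquiv F σ x = (σ x : ℂ) := rfl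

lemma card_realEmbedding : Fintype.card (F →+* ℝ) = Module.finrank ℚ F := by
  rw [Fintype.card_congr (realEmbeddingEquiv F), AlgHom.card]

lemma norm_eq_prod_realEmbedding (x : F) :
    ((Algebra.norm ℚ x : ℚ) : ℂ) = ∏ σ : F →+* ℝ, (σ x : ℂ) := by
  have h := Algebra.norm_eq_prod_embeddings ℚ ℂ x
  rw [← (realEmbeddingEquiv F).prod_comp] at h
  simpa [realEmbeddingEquiv_apply] using h

lemma trace_eq_sum_realEmbedding (x : F) :
    ((Algebra.trace ℚ F x : ℚ) : ℂ) = ∑ σ : F →+* ℝ, (σ x : ℂ) := by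
  have h := trace_eq_sum_embeddings (K := ℚ) ℂ (x := x)
  rw [← (realEmbeddingEquiv F).sum_comp] at h
  simpa [realEmbeddingEquiv_apply] using h

lemma prod_ofReal_cpow {A : Type*} (S : Finset A) (f : A → ℝ) (h : ∀ i ∈ S, 0 < f i) (s : ℂ) :
    (∏ i ∈ S, (f i : ℂ)) ^ s = ∏ i ∈ S, (f i : ℂ) ^ s := by
  classical
  induction S using Finset.induction_on with
  | empty => simp
  | insert i S hi ih =>
    have h1 : ∀ j ∈ S, 0 < f j := fun j hj => h j (by simp [hj])
    rw [Finset.prod_insert hi, Finset.prod_insert hi, ← ih h1, ← Complex.ofReal_prod,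
      Complex.mul_cpow_ofReal_nonneg (h i (by simp)).le
        (Finset.prod_nonneg fun j hj => (h1 j hj).le)]

lemma norm_cpow_translate {m : ℕ} {α : Fin m → F} {δ : F} (hδ : ∀ σ : F →+* ℝ, 0 < σ δ)
    (hα : ∀ (j : Fin m) (σ : F →+* ℝ), 0 < σ (α j)) (x : Fin m → ℕ) (s : ℂ) :
    ((Algebra.norm ℚ (translate α δ x) : ℚ) : ℂ) ^ (-s) =
      powProd (fun σ : F →+* ℝ => σ δ) (fun σ j => σ (α j)) (fun _ => s) x := by
  have h : ∀ σ : F →+* ℝ, σ (translate α δ x) = affineForm (σ δ) (fun j => σ (α j)) x := by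
    intro σ
    simp [translate, affineForm, Algebra.smul_def, mul_comm]
  rw [norm_eq_prod_realEmbedding, prod_ofReal_cpow _ _ fun σ _ => ?_]
  · simp only [h, powProd]
  · rw [h]
    exact affineForm_pos (hδ σ) (fun j => hα j σ) x

end TotallyReal

/-! ### Primitive generators and dual forms -/

section Dual

variable {F : Type*} [Field F] [CharZero F] {L : Submodule ℤ F} {n : ℕ}
  {a : Fin n → Module.Dual ℚ F} {α : Fin n → F}

/-- Two primitive vectors of `L` on the same ray are equal. -/
lemma IsPrimitiveIn.eq_of_smul_eq {x y : F} (hx : IsPrimitiveIn L x) (hy : IsPrimitiveIn L y)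
    {q : ℚ} (hq : 0 < q) (h : x = q • y) : x = y := by
  -- With `q = p / r` in lowest terms, `x = p z` and `y = r z` for the lattice vector `z = u x + w y`
  -- given by a Bézout relation `u p + w r = 1`.
  obtain ⟨p, hp⟩ : ∃ p : ℕ, q.num = p := Int.eq_ofNat_of_zero_le (Rat.num_nonneg.2 hq.le)
  have hcop : IsCoprime (p : ℤ) (q.den : ℤ) := by
    have := q.reduced
    rw [hp, Int.natAbs_natCast] at this
    exact Nat.isCoprime_iff_coprime.2 this
  obtain ⟨u, w, huw⟩ := hcop
  have hden : (q.den : ℚ) ≠ 0 := by exact_mod_cast q.den_pos.ne'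
  have hrel : (q.den : ℚ) • x = (p : ℚ) • y := by
    rw [h, smul_smul]
    congr 1
    rw [mul_comm, Rat.mul_den_eq_num, hp]
    simp
  have huw' : (u : F) * p + w * q.den = 1 := by exact_mod_cast congrArg (Int.cast : ℤ → F) huw
  have hrel' : (q.den : F) * x = p * y := by simpa [Algebra.smul_def] using hrel
  set z : F := u • x + w • y with hz
  have hzL : z ∈ L := add_mem (L.smul_mem _ hx.1) (L.smul_mem _ hy.1)
  have hz' : z = u * x + w * y := by simp [hz]
  have hxz : x = p * z := by
    rw [hz']
    linear_combination (-x) * huw' + (w : F) * hrel'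
  have hyz : y = q.den * z := by
    rw [hz']
    linear_combination (-y) * huw' - (u : F) * hrel'
  have hp1 : 1 ≤ p := by
    have := Rat.num_pos.2 hq
    omega
  have hp' := hx.2 p hp1 z hzL (by rw [hxz, nsmul_eq_mul])
  have hr' := hy.2 q.den q.den_pos z hzL (by rw [nsmul_eq_mul]; exact hyz)
  rw [hxz, hyz, hp', hr']

/-- A primitive positive dual family is unique. -/
lemma IsPrimitivePositiveDual.unique {β γ : Fin n → F} (hα : ∀ x, (∀ k, a k x = 0) → x = 0)
    (hβ : IsPrimitivePositiveDual L a β) (hγ : IsPrimitivePositiveDual L a γ) : β = γ := by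
  funext j
  refine (hβ.1 j).eq_of_smul_eq (hγ.1 j) (div_pos (hβ.2.1 j) (hγ.2.1 j)) ?_
  refine sub_eq_zero.1 (hα _ fun k => ?_)
  rw [map_sub, map_smul, smul_eq_mul]
  rcases eq_or_ne k j with rfl | hk
  · rw [div_mul_cancel₀ _ (hγ.2.1 k).ne', sub_self]
  · rw [hβ.2.2 j k hk, hγ.2.2 j k hk]
    simp

lemma dual_generator_nonneg (hcone : dualCone a = closedCone α) (i k : Fin n) : 0 ≤ a k (α i) := by
  have : α i ∈ dualCone a := hcone ▸ generator_mem_closedCone i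
  exact this k

/-- If the cone spanned by the basis `α` is dual to the family `a`, then `α` is, up to a
permutation, dual to `a`: both the matrix `a_k(α_i)` and its inverse are nonnegative. -/
lemma exists_perm_dual (hcone : dualCone a = closedCone α)
    (hdual : ∃ β : Fin n → F, ∀ j k, a k (β j) = if k = j then 1 else 0) :
    ∃ π : Equiv.Perm (Fin n), (∀ j, 0 < a j (α (π j))) ∧ ∀ j k, k ≠ j → a k (α (π j)) = 0 := by
  obtain ⟨β, hβ⟩ := hdual
  have hβmem : ∀ j, β j ∈ closedCone α := fun j => by
    rw [← hcone]
    intro k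
    rw [hβ]
    split_ifs <;> norm_num
  choose c hc0 hc using hβmem
  have hsum : ∀ j k, ∑ i, c j i * a k (α i) = if k = j then 1 else 0 := fun j k => by
    rw [← hβ, hc j]
    simp
  have hex : ∀ j, ∃ i, 0 < c j i * a j (α i) := fun j => by
    by_contra! hcon
    have h1 := hsum j j
    rw [if_pos rfl] at h1
    have := Finset.sum_nonpos fun i (_ : i ∈ Finset.univ) => hcon i
    linarith
  choose f hf using hex
  have hcf : ∀ j, 0 < c j (f j) := fun j =>
    pos_of_mul_pos_left (hf j) (dual_generator_nonneg hcone _ _)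
  have hzero : ∀ j k, k ≠ j → a k (α (f j)) = 0 := by
    intro j k hk
    have h1 := hsum j k
    rw [if_neg hk, Finset.sum_eq_zero_iff_of_nonneg fun i _ =>
      mul_nonneg (hc0 j i) (dual_generator_nonneg hcone _ _)] at h1
    exact (mul_eq_zero.1 (h1 (f j) (Finset.mem_univ _))).resolve_left (hcf j).ne'
  have hpos : ∀ j, 0 < a j (α (f j)) := fun j => pos_of_mul_pos_right (hf j) (hc0 j _)
  have hinj : Function.Injective f := by
    intro j k hjk
    by_contra hne
    have h1 := hzero k j hne
    rw [← hjk] at h1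
    exact (hpos j).ne' h1
  exact ⟨Equiv.ofBijective f (Finite.injective_iff_bijective.1 hinj), hpos, hzero⟩

/-- For an independent family `a` whose dual cone is generated by the primitive vectors `α`, the
Bernoulli function is `h_0`. -/
lemma geometricBernoulli_eq_hZero {K : Type*} [Field K] [CharZero K] (hL : L.FG) {v : F ⧸ L}
    (hspan : ∀ x : F, ∃ c : Fin n → ℚ, x = ∑ i, c i • α i)
    (hind : LinearIndependent ℚ α) (hprim : ∀ j, IsPrimitiveIn L (α j))
    (hcone : dualCone a = closedCone α) (b : Module.Basis (Fin n) ℤ L)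
    (hdet : SignType.sign (formDet b a) = 1) (w : K) {x : F →ₗ[ℚ] K} (hx : ∀ j, x (α j) ≠ 0) :
    geometricBernoulli b a v w x = hZero α v w x := by
  have hdual : ∃ β : Fin n → F, ∀ j k, a k (β j) = if k = j then 1 else 0 := by
    set M : Matrix (Fin n) (Fin n) ℚ := Matrix.of fun i j => a i (b j : F) with hM
    have hMdet : IsUnit M.det := by
      refine isUnit_iff_ne_zero.2 fun h => ?_
      have : formDet b a = 0 := h
      rw [this] at hdet
      simp at hdet
    refine ⟨fun j => ∑ i, M⁻¹ i j • (b i : F), fun j k => ?_⟩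
    have h := congrFun (congrFun (Matrix.mul_nonsing_inv M hMdet) k) j
    rw [Matrix.mul_apply, Matrix.one_apply] at h
    rw [← h, map_sum]
    refine Finset.sum_congr rfl fun i _ => ?_
    rw [map_smul, smul_eq_mul, mul_comm]
    rfl
  obtain ⟨π, hπpos, hπzero⟩ := exists_perm_dual hcone hdual
  have happ : ∀ (c : Fin n → ℚ) (k : Fin n), a k (∑ i, c i • α (π i)) = c k * a k (α (π k)) := by
    intro c k
    rw [map_sum, Finset.sum_eq_single k]
    · rw [map_smul, smul_eq_mul]
    · intro i _ hi
      rw [map_smul, hπzero i k hi.symm, smul_zero]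
    · simp
  have hspan' : ∀ x : F, ∃ c : Fin n → ℚ, x = ∑ i, c i • α (π i) := fun x => by
    obtain ⟨c, hc⟩ := hspan x
    exact ⟨fun i => c (π i), by rw [hc]; exact (Equiv.sum_comp π fun i => c i • α i).symm⟩
  have hsep : ∀ x, (∀ k, a k x = 0) → x = 0 := by
    intro x hx0
    obtain ⟨c, rfl⟩ := hspan' x
    refine Finset.sum_eq_zero fun k _ => ?_
    have := hx0 k
    rw [happ] at this
    rw [(mul_eq_zero.1 this).resolve_right (hπpos k).ne', zero_smul]
  have hppd : IsPrimitivePositiveDual L a fun j => α (π j) :=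
    ⟨fun j => hprim _, hπpos, hπzero⟩
  have hex : ∃ β : Fin n → F, IsPrimitivePositiveDual L a β := ⟨_, hppd⟩
  have hchoose : hex.choose = fun j => α (π j) := hex.choose_spec.unique hsep hppd
  have hbox : dualBox a (fun j => α (π j)) v = parallelotope α ∩ coset v := by
    ext δ
    constructor
    · rintro ⟨hv, hδ⟩
      refine ⟨?_, hv⟩
      obtain ⟨c, rfl⟩ := hspan' δ
      refine ⟨fun i => c (π.symm i), fun i => ?_, ?_⟩
      · have h1 := hδ (π.symm i)
        rw [happ] at h1
        have h2 := hπpos (π.symm i)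
        constructor
        · exact nonneg_of_mul_nonneg_left h1.1 h2
        · nlinarith [h1.2]
      · rw [← Equiv.sum_comp π fun i => c (π.symm i) • α i]
        simp
    · rintro ⟨⟨c, hc, rfl⟩, hv⟩
      refine ⟨hv, fun j => ?_⟩
      rw [← Equiv.sum_comp π, happ fun i => c (π i)]
      have h2 := hπpos j
      exact ⟨mul_nonneg (hc _).1 h2.le, by nlinarith [(hc (π j)).2]⟩
  have hfin := finite_parallelotope_inter_coset (v := v) hL hind
  have hsign : (((SignType.sign ((-1) ^ n * formDet b a) : SignType) : ℤ) : K) = (-1) ^ n := by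
    rw [sign_mul, hdet, mul_one, sign_pow, Left.sign_neg, sign_one]
    simp
  have htodd : ∀ y : K, todd y (fun j => x (α (π j))) = todd y fun j => x (α j) := fun y => by
    rw [todd, todd, Equiv.prod_comp π fun j => (expQuot (x (α j)))⁻¹]
  rw [geometricBernoulli, dif_pos hex, hchoose, hbox, hsign, hZero_eq_sum hfin w hx,
    finsum_mem_eq_finite_toFinset_sum _ hfin, Finset.mul_sum, Finset.mul_sum]
  refine Finset.sum_congr rfl fun δ _ => ?_
  rw [multipleBernoulli_eq n _ fun j => hx (π j), htodd]
  have h1 : (n.factorial : K) ≠ 0 := by exact_mod_cast n.factorial_ne_zero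
  have h2 : ∏ j, x (α (π j)) ≠ 0 := Finset.prod_ne_zero_iff.2 fun j _ => hx _
  have h3 : ((-1 : K) ^ n) * (-1) ^ n = 1 := by rw [← mul_pow]; simp
  field_simp
  rw [pow_two, h3, one_mul]

end Dual

end ShintaniCone

open ShintaniCone in
theorem proposition15 {F : Type*} [Field F] [NumberField F] [NumberField.IsTotallyReal F]
    {n : ℕ} (hn : Module.finrank ℚ F = n)
    (L : Submodule ℤ F) (hL : L.IsLattice ℚ)
    {m : ℕ} (hm : 1 ≤ m) (α : Fin m → F)
    (hprim : ∀ j, IsPrimitiveIn L (α j)) (hind : LinearIndependent ℚ α)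
    (hpos : closedCone α ⊆ totallyPositive F ∪ {0})
    (v : F ⧸ L) (hv : v ≠ 0) :
    ∃ Z : ℂ → ℂ, IsConeZeta (closedCone α) v Z ∧ AnalyticAt ℂ Z 0 ∧
      Z 0 = ((1 / (n : ℝ) * ∑ σ : F →+* ℝ, hZero α v 0 (-embForm σ) : ℝ) : ℂ) ∧
      (m = n → ∀ (b : Module.Basis (Fin n) ℤ L) (a : Fin n → Module.Dual ℚ F),
        (∀ j, ∀ l ∈ L, ∃ k : ℤ, a j l = (k : ℚ)) →
        dualCone a = closedCone α → SignType.sign (formDet b a) = 1 →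
        Z 0 = ((1 / (n : ℝ) * ∑ σ : F →+* ℝ,
          geometricBernoulli b a v 0 (-embForm σ) : ℝ) : ℂ)) ∧
      (∃ β : F, (∀ σ : F →+* ℝ, σ β = 1 / (n : ℝ) * hZero α v 0 (-embForm σ)) ∧
        Z 0 = ((Algebra.trace ℚ F β : ℚ) : ℂ)) ∧
      ∃ q : ℚ, Z 0 = (q : ℂ) := by
  have hfin := finite_parallelotope_inter_coset (v := v) hL.fg hind
  have hcard : Fintype.card (F →+* ℝ) = n := card_realEmbedding.trans hn
  have hmn : m ≤ Fintype.card (F →+* ℝ) := by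
    rw [hcard, ← hn]
    simpa using hind.fintype_card_le_finrank
  have hn0 : 0 < n := hn ▸ Module.finrank_pos
  have : Nonempty (F →+* ℝ) := Fintype.card_pos_iff.1 (hcard ▸ hn0)
  have hα : ∀ (j : Fin m) (σ : F →+* ℝ), 0 < σ (α j) := fun j σ =>
    (hpos (generator_mem_closedCone j)).resolve_right (hind.ne_zero j) σ
  -- As `v ≠ 0`, the points of the parallelotope in the coset are non-zero.
  have hδ : ∀ δ ∈ parallelotope α ∩ coset v, ∀ σ : F →+* ℝ, 0 < σ δ := by
    rintro δ ⟨hδP, hδv⟩ σ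
    refine (hpos (parallelotope_subset_closedCone hδP)).resolve_right (fun h0 => hv ?_) σ
    rw [Set.mem_singleton_iff.1 h0] at hδv
    exact hδv.symm
  have hx : ∀ (σ : F →+* ℝ) (j : Fin m), (-embForm σ) (α j) ≠ 0 := fun σ j =>
    neg_ne_zero.2 (hα j σ).ne'
  have hzeta : ∀ δ : F, ∃ Z : ℂ → ℂ, δ ∈ parallelotope α ∩ coset v →
      Meromorphic Z ∧ AnalyticAt ℂ Z 0 ∧
      (∀ s : ℂ, 1 < s.re → HasSum (fun x => powProd (fun σ : F →+* ℝ => σ δ)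
        (fun σ j => σ (α j)) (fun _ => s) x) (Z s)) ∧
      Z 0 = ((1 / (n : ℝ) * ∑ σ : F →+* ℝ,
        PowerSeries.coeff m (todd (-σ δ) fun j => -σ (α j)) : ℝ) : ℂ) := by
    intro δ
    by_cases h : δ ∈ parallelotope α ∩ coset v
    · obtain ⟨Z, hZ⟩ := exists_zeta (c := fun σ : F →+* ℝ => σ δ) (l := fun σ j => σ (α j))
        (fun σ => hδ δ h σ) (fun σ j => hα j σ) hmn
      rw [hcard] at hZ
      exact ⟨Z, fun _ => hZ⟩
    · exact ⟨0, fun h' => absurd h' h⟩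
  choose Z hZ using hzeta
  have hmem : ∀ {δ}, δ ∈ hfin.toFinset → δ ∈ parallelotope α ∩ coset v := fun h =>
    hfin.mem_toFinset.1 h
  have hval : ∑ δ ∈ hfin.toFinset, Z δ 0 =
      ((1 / (n : ℝ) * ∑ σ : F →+* ℝ, hZero α v 0 (-embForm σ) : ℝ) : ℂ) := by
    rw [Finset.sum_congr rfl fun δ hd => (hZ δ (hmem hd)).2.2.2, ← Complex.ofReal_sum,
      ← Finset.mul_sum, Finset.sum_comm]
    congr 2
    refine Finset.sum_congr rfl fun σ _ => ?_
    rw [hZero_eq_sum hfin 0 (hx σ)]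
    refine Finset.sum_congr rfl fun δ _ => ?_
    rw [zero_add]
    rfl
  set β : F := (n : F)⁻¹ * hZero α v 0 (-LinearMap.id : F →ₗ[ℚ] F) with hβdef
  have hβ : ∀ σ : F →+* ℝ, σ β = 1 / (n : ℝ) * hZero α v 0 (-embForm σ) := fun σ => by
    rw [hβdef, map_mul, map_inv₀, map_natCast, one_div,
      map_hZero σ hfin 0 (x' := -embForm σ) (fun j => by simpa using hind.ne_zero j)
        (fun y => by rw [LinearMap.neg_apply, map_neg]; rfl), map_zero]
  have htrace : ∑ δ ∈ hfin.toFinset, Z δ 0 = ((Algebra.trace ℚ F β : ℚ) : ℂ) := by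
    rw [hval, trace_eq_sum_realEmbedding, ← Complex.ofReal_sum, Finset.mul_sum]
    simp only [hβ]
  refine ⟨fun s => ∑ δ ∈ hfin.toFinset, Z δ s, ⟨?_, fun s hs => ?_⟩, ?_, hval, ?_,
    ⟨β, hβ, htrace⟩, _, htrace⟩
  · exact fun s => MeromorphicAt.fun_sum fun δ hd => (hZ δ (hmem hd)).1 s
  · have hset : closedCone α ∩ coset v = ⋃ δ ∈ hfin.toFinset, Set.range (translate α δ) := by
      rw [closedCone_inter_coset fun j => (hprim j).1]
      simp
    rw [hset]
    refine hasSum_sum_disjoint (f := fun μ : F => ((Algebra.norm ℚ μ : ℚ) : ℂ) ^ (-s)) _ ?_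
      fun δ hd => ?_
    · intro δ hd δ' hd' hne
      refine Set.disjoint_left.2 ?_
      rintro _ ⟨x, rfl⟩ ⟨y, hy⟩
      exact hne (translate_eq_iff hind (hmem hd).1 (hmem hd').1 hy.symm)
    · refine ((translate_injective hind δ).hasSum_range_iff
        (f := fun μ : F => ((Algebra.norm ℚ μ : ℚ) : ℂ) ^ (-s))).2 ?_
      convert! (hZ δ (hmem hd)).2.2.1 s hs using 1
      funext x
      exact norm_cpow_translate (hδ δ (hmem hd)) hα x s
  · exact Finset.analyticAt_fun_sum _ fun δ hd => (hZ δ (hmem hd)).2.1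
  · rintro rfl b a - hcone hdet
    have hspan : ∀ x : F, ∃ c : Fin m → ℚ, x = ∑ i, c i • α i := by
      intro x
      have htop := hind.span_eq_top_of_card_eq_finrank' (by rw [Fintype.card_fin, hn])
      obtain ⟨c, hc⟩ := (Submodule.mem_span_range_iff_exists_fun ℚ).1
        (htop ▸ Submodule.mem_top : x ∈ Submodule.span ℚ (Set.range α))
      exact ⟨c, hc.symm⟩
    change ∑ δ ∈ hfin.toFinset, Z δ 0 = _
    rw [hval]
    congr 3
    funext σ
    exact (geometricBernoulli_eq_hZero hL.fg hspan hind hprim hcone b hdet 0 (hx σ)).symm
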